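/- For a group $H$ with injective homomorphisms $f_1\colon H\to G_1$ and $f_2\colon H\to G_2$, the amalgamated product $G_1*_HG_2$ is the quotient of the free product $G_1*G_2$ by the normal subgroup generated by the elements $f_1(h)f_2(h)^{-1}$, $h\in H$; it is called non-trivial if neither $f_1$ nor $f_2$ is surjective. A group is virtually a non-trivial amalgamated product if it has a subgroup of finite index that is isomorphic to a non-trivial amalgamated product. For a finite group $G$, let $\mathcal U(\mathbb ZG)$ be the unit group of the integral group ring, let $\mathbb QG\cong\prod_i \mathrm M_{n_i}(D_i)$ be the Wedderburn–Artin decomposition of the rational group algebra, with projections $h_i$ onto the components, and let $\mathrm{SL}_1(\mathbb ZG)$ be the group of all $a\in\mathcal U(\mathbb ZG)$ such that, for every $i$, the reduced norm of $h_i(a)$ over the centre $\mathcal Z(D_i)$ is $1$. (The reduced norm of an element $a$ of a finite-dimensional central simple $K$-algebra $A$ is $\det(1\otimes a)$, computed in $E\otimes_KA\cong \mathrm M_n(E)$ for any splitting field $E$ of $A$.) Let $G$ be a finite group that has $D_8$ (the dihedral group of order $8$) or $S_3$ as an epimorphic image. Then every subgroup of finite index of $\mathrm{SL}_1(\mathbb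 ZG)$ is isomorphic to a non-trivial amalgamated product. Moreover, $\mathcal U(\mathbb ZG)$ is virtually a non-trivial amalgamated product. -/

import Mathlib

open scoped TensorProduct

universe u

/-! ### Amalgamated products -/

section Amalgam

variable {G₁ G₂ H : Type u} [Group G₁] [Group G₂] [Group H]

/-- The free product with amalgamation `G₁ *_H G₂` of two homomorphisms `f₁ : H → G₁` and
`f₂ : H → G₂`: the quotient of the free product `G₁ * G₂` by the normal subgroup generated by the
elements `f₁ h * (f₂ h)⁻¹`, for `h ∈ H`. -/
abbrev AmalgamatedProduct (f₁ : H →* G₁) (f₂ : H →* G₂) : Type u :=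
  Monoid.Coprod G₁ G₂ ⧸ Subgroup.normalClosure
    (Set.range fun h : H =>
      (Monoid.Coprod.inl (f₁ h) * (Monoid.Coprod.inr (f₂ h))⁻¹ : Monoid.Coprod G₁ G₂))

end Amalgam

/-- `Γ` is a non-trivial amalgamated product: it is isomorphic to `G₁ *_H G₂` for some groups and
some injective homomorphisms `f₁ : H → G₁`, `f₂ : H → G₂`, neither of which is surjective.
(Since `G₁`, `G₂` and `H` embed in `G₁ *_H G₂`, nothing is lost by taking them in the universe
of `Γ`.) -/
def IsNontrivialAmalgam (Γ : Type u) [Group Γ] : Prop :=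
  ∃ (G₁ G₂ H : Type u) (_ : Group G₁) (_ : Group G₂) (_ : Group H) (f₁ : H →* G₁) (f₂ : H →* G₂),
    Function.Injective f₁ ∧ Function.Injective f₂ ∧
    ¬ Function.Surjective f₁ ∧ ¬ Function.Surjective f₂ ∧
    Nonempty (Γ ≃* AmalgamatedProduct f₁ f₂)

/-- `Γ` is virtually a non-trivial amalgamated product: some subgroup of finite index is one. -/
def IsVirtuallyNontrivialAmalgam (Γ : Type u) [Group Γ] : Prop :=
  ∃ K : Subgroup Γ, K.FiniteIndex ∧ IsNontrivialAmalgam K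

/-! ### Reduced norms and `SL₁` -/

/-- For a finite-dimensional central simple `K`-algebra `A`, the element `a` has reduced norm `c`:
for every splitting field `E` of `A` and every isomorphism `φ : E ⊗[K] A ≃ Mₙ(E)` of `E`-algebras,
`det (φ (1 ⊗ a)) = c`. Splitting fields exist in the universe of `K` (for instance an algebraic
closure of `K`), and the determinant depends neither on `E` nor on `φ`, so that one could equally
well ask for this for one choice of `E` and `φ`. -/
def HasReducedNorm (K : Type u) {A : Type u} [Field K] [Ring A] [Algebra K A] (a : A) (c : K) :
    Prop :=
  ∀ (E : Type u) [Field E] [Algebra K E] (n : ℕ) (φ : E ⊗[K] A ≃ₐ[E] Matrix (Fin n) (Fin n) E),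
    (φ (1 ⊗ₜ[K] a)).det = algebraMap K E c

/-- A Wedderburn–Artin decomposition `A ≅ ∏ i, M_{nᵢ}(Dᵢ)` of a semisimple ring `A`, with `Dᵢ`
division rings and `nᵢ ≥ 1`. -/
structure WedderburnDecomposition (A : Type u) [Ring A] where
  /-- the number of simple components -/
  k : ℕ
  /-- the division rings -/
  D : Fin k → Type u
  /-- each `D i` is a division ring -/
  [divisionRing : ∀ i, DivisionRing (D i)]
  /-- the sizes of the matrices -/
  n : Fin k → ℕ
  n_pos : ∀ i, 0 < n i
  /-- the isomorphism -/
  iso : A ≃+* Π i, Matrix (Fin (n i)) (Fin (n i)) (D i)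

attribute [instance] WedderburnDecomposition.divisionRing

/-- The element `a` of the semisimple ring `A` (finite-dimensional over `ℚ`) has reduced norm `1`
in every simple component `M_{nᵢ}(Dᵢ)`, over the centre of `Dᵢ`. The Wedderburn–Artin decomposition
is unique up to permutation and isomorphism of the components, so that the condition is the same
for all of them. -/
def HasReducedNormsOne {A : Type u} [Ring A] (a : A) : Prop :=
  ∀ (W : WedderburnDecomposition A) (i : Fin W.k),
    HasReducedNorm (Subring.center (W.D i)) (W.iso a i) 1

theorem HasReducedNorm.mul {K A : Type u} [Field K] [Ring A] [Algebra K A] {a b : A} {c d : K}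
    (ha : HasReducedNorm K a c) (hb : HasReducedNorm K b d) : HasReducedNorm K (a * b) (c * d) := by
  intro E _ _ n φ
  have h : (1 : E) ⊗ₜ[K] (a * b) = (1 ⊗ₜ[K] a) * (1 ⊗ₜ[K] b) := by simp
  rw [h, map_mul, Matrix.det_mul, ha E n φ, hb E n φ, map_mul]

theorem HasReducedNorm.one {K A : Type u} [Field K] [Ring A] [Algebra K A] :
    HasReducedNorm K (1 : A) 1 := by
  intro E _ _ n φ
  rw [← Algebra.TensorProduct.one_def, map_one, Matrix.det_one, map_one]

theorem HasReducedNorm.of_mul_eq_one {K A : Type u} [Field K] [Ring A] [Algebra K A] {a b : A}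
    (ha : HasReducedNorm K a 1) (hab : a * b = 1) : HasReducedNorm K b 1 := by
  intro E _ _ n φ
  have h : (1 : E) ⊗ₜ[K] (a * b) = (1 ⊗ₜ[K] a) * (1 ⊗ₜ[K] b) := by simp
  have h' := HasReducedNorm.one (K := K) (A := A) E n φ
  rw [← hab, h, map_mul, Matrix.det_mul, ha E n φ, map_one, one_mul] at h'
  rw [h', map_one]

/-- For a subring `R` of a semisimple `ℚ`-algebra `A`, given by its inclusion `j : R → A`, the group
`SL₁(R)` of the units of `R` all of whose reduced norms, in the simple components of `A`, are `1`. -/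
def SL₁ {R A : Type u} [Ring R] [Ring A] (j : R →+* A) : Subgroup Rˣ where
  carrier := {a | HasReducedNormsOne (j a)}
  one_mem' := by
    intro W i
    simpa using HasReducedNorm.one
  mul_mem' := by
    intro a b ha hb W i
    have h := (ha W i).mul (hb W i)
    simpa using h
  inv_mem' := by
    intro a ha W i
    refine (ha W i).of_mul_eq_one ?_
    rw [← Pi.mul_apply, ← map_mul, ← map_mul, Units.mul_inv, map_one, map_one, Pi.one_apply]

/-- The inclusion of the integral group ring `ℤG` into the rational group algebra `ℚG`. -/
noncomputable def groupRingInclusion (G : Type u) [Group G] :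
    MonoidAlgebra ℤ G →+* MonoidAlgebra ℚ G :=
  MonoidAlgebra.mapRingHom G (Int.castRingHom ℚ)

/-! Both claims rest on one criterion: a group with a homomorphism to SL₂(ℤ) of finite-index image
is a non-trivial amalgam (`IsNontrivialAmalgam.of_hom_to_SL2Z`). Such a group maps onto a
finite-index subgroup of PSL₂(ℤ) ≅ ℤ/2 * ℤ/3. That subgroup maps onto a free product of two
non-trivial cyclic groups (`IsFreeProductTwoThree.exists_surjective_coprod`), and a group with a
quotient A * B is the amalgam of the preimages of A and B over the kernel
(`IsNontrivialAmalgam.of_surjective`). The map to SL₂(ℤ) may have any kernel.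

The homomorphism comes from an integral representation ρ of degree 2, inflated from D₈ or S₃. It
satisfies Schur's relations with an integer constant c ≠ 0. Writing an element of Γ(c) as 1 + cx,
the element 1 + ∑ tr(ρ(g)⁻¹x) g is a unit of ℤG lying over it and trivial in all other components
(`exists_unit_of_mem_Gamma`).

This unit belongs to SL₁(ℤG): the determinant in any splitting of any component yields a
multiplicative map from SL₂(ℚ) to a commutative monoid, which kills SL₂(ℤ) because SL₂(ℤ) lies in
the derived subgroup of SL₂(ℚ) (`SL2Q_hom_eq_one`). Conversely, ρ sends SL₁(ℤG) into SL₂(ℤ)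
(`SL₁_le_ker_unitDet`), so the image contains Γ(c). -/

/-! ### Amalgams from maps onto free products -/

theorem Monoid.Coprod.closure_range_union (A B : Type*) [Group A] [Group B] :
    Subgroup.closure (Set.range (Monoid.Coprod.inl : A →* Monoid.Coprod A B) ∪
      Set.range (Monoid.Coprod.inr : B →* Monoid.Coprod A B)) = ⊤ := by
  rw [Subgroup.closure_union, ← MonoidHom.coe_range, ← MonoidHom.coe_range,
    Subgroup.closure_eq, Subgroup.closure_eq, Monoid.Coprod.range_inl_sup_range_inr]

/-- A group that maps onto a free product of two non-trivial groups is a non-trivial amalgamated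
product: amalgamate the preimages of the two factors over the kernel. -/
theorem IsNontrivialAmalgam.of_surjective {Γ : Type u} [Group Γ] {A B : Type} [Group A] [Group B]
    [Nontrivial A] [Nontrivial B] (φ : Γ →* Monoid.Coprod A B) (hφ : Function.Surjective φ) :
    IsNontrivialAmalgam Γ := by
  let iA : A →* Monoid.Coprod A B := Monoid.Coprod.inl
  let iB : B →* Monoid.Coprod A B := Monoid.Coprod.inr
  let G₁ : Subgroup Γ := iA.range.comap φ
  let G₂ : Subgroup Γ := iB.range.comap φ
  let H : Subgroup Γ := φ.ker
  have h₁ : H ≤ G₁ := fun x hx => by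
    change φ x ∈ iA.range
    rw [MonoidHom.mem_ker.1 hx]; exact one_mem _
  have h₂ : H ≤ G₂ := fun x hx => by
    change φ x ∈ iB.range
    rw [MonoidHom.mem_ker.1 hx]; exact one_mem _
  let f₁ : H →* G₁ := Subgroup.inclusion h₁
  let f₂ : H →* G₂ := Subgroup.inclusion h₂
  refine ⟨G₁, G₂, H, inferInstance, inferInstance, inferInstance, f₁, f₂,
    Subgroup.inclusion_injective h₁, Subgroup.inclusion_injective h₂, ?_, ?_, ?_⟩
  · intro hs
    obtain ⟨a, ha⟩ := exists_ne (1 : A)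
    obtain ⟨x, hx⟩ := hφ (iA a)
    obtain ⟨y, hy⟩ := hs ⟨x, a, hx.symm⟩
    have : (y : Γ) = x := congrArg Subtype.val hy
    have h1 : φ x = 1 := this ▸ y.2
    exact ha (Monoid.Coprod.inl_injective (N := B) (by rw [map_one, ← h1, hx]))
  · intro hs
    obtain ⟨a, ha⟩ := exists_ne (1 : B)
    obtain ⟨x, hx⟩ := hφ (iB a)
    obtain ⟨y, hy⟩ := hs ⟨x, a, hx.symm⟩
    have : (y : Γ) = x := congrArg Subtype.val hy
    have h1 : φ x = 1 := this ▸ y.2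
    exact ha (Monoid.Coprod.inr_injective (M := A) (by rw [map_one, ← h1, hx]))
  let R : Set (Monoid.Coprod G₁ G₂) := Set.range fun h : H =>
    (Monoid.Coprod.inl (f₁ h) * (Monoid.Coprod.inr (f₂ h))⁻¹ : Monoid.Coprod G₁ G₂)
  let q : Monoid.Coprod G₁ G₂ →* AmalgamatedProduct f₁ f₂ := QuotientGroup.mk' _
  let j₁ : G₁ →* AmalgamatedProduct f₁ f₂ := q.comp Monoid.Coprod.inl
  let j₂ : G₂ →* AmalgamatedProduct f₁ f₂ := q.comp Monoid.Coprod.inr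
  have hj : ∀ h : H, j₁ (f₁ h) = j₂ (f₂ h) := by
    intro h
    rw [← mul_inv_eq_one]
    exact (QuotientGroup.eq_one_iff _).2 (Subgroup.subset_normalClosure ⟨h, rfl⟩)
  let ψ₀ : Monoid.Coprod G₁ G₂ →* Γ := Monoid.Coprod.lift G₁.subtype G₂.subtype
  have hψ₀ : Subgroup.normalClosure R ≤ ψ₀.ker := by
    refine Subgroup.normalClosure_le_normal ?_
    rintro _ ⟨h, rfl⟩
    simp [ψ₀, f₁, f₂, MonoidHom.mem_ker]
  let ψ : AmalgamatedProduct f₁ f₂ →* Γ := QuotientGroup.lift _ ψ₀ hψ₀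
  have hψ₁ : ∀ x, ψ (j₁ x) = x := fun x => rfl
  have hψ₂ : ∀ x, ψ (j₂ x) = x := fun x => rfl
  have gen : ∀ S : Subgroup (AmalgamatedProduct f₁ f₂), (∀ x, j₁ x ∈ S) → (∀ x, j₂ x ∈ S) →
      ∀ x, x ∈ S := by
    intro S hS₁ hS₂ x
    obtain ⟨x, rfl⟩ := QuotientGroup.mk'_surjective _ x
    have : (⊤ : Subgroup (Monoid.Coprod G₁ G₂)) ≤ S.comap q := by
      rw [← Monoid.Coprod.closure_range_union, Subgroup.closure_le]
      rintro _ (⟨y, rfl⟩ | ⟨y, rfl⟩)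
      exacts [hS₁ y, hS₂ y]
    exact this (Subgroup.mem_top x)
  -- `N` is the copy of `φ.ker` in the amalgam. Modulo `N`, the maps `j₁` and `j₂` descend to `A`
  -- and `B`, so `A * B` maps to the quotient by `N`, and composing with `φ ∘ ψ` gives back `π`.
  -- Hence `ψ.ker` lies in `N`, where `ψ` is visibly injective.
  let N : Subgroup (AmalgamatedProduct f₁ f₂) := (j₁.comp f₁).range
  have hN : N.Normal := by
    rw [← Subgroup.normalizer_eq_top_iff, eq_top_iff]
    intro x _
    have key : ∀ {G' : Subgroup Γ} (hG : H ≤ G') (j : G' →* AmalgamatedProduct f₁ f₂)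
        (_ : ∀ h : H, j (Subgroup.inclusion hG h) = j₁ (f₁ h)) (x : G'), j x ∈ Subgroup.normalizer (N : Set _) := by
      intro G' hG j hjj x
      have hle : ∀ (x : G') (n), n ∈ N → j x * n * (j x)⁻¹ ∈ N := by
        rintro x _ ⟨h, rfl⟩
        refine ⟨⟨x * h * (x : Γ)⁻¹, (MonoidHom.normal_ker φ).conj_mem _ h.2 _⟩, ?_⟩
        change j₁ (f₁ _) = j x * j₁ (f₁ h) * (j x)⁻¹
        rw [← hjj, ← hjj, ← map_inv, ← map_mul,
          ← map_mul]
        rfl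
      rw [Subgroup.mem_normalizer_iff]
      refine fun n => ⟨hle x n, fun hn => ?_⟩
      have := hle x⁻¹ _ hn
      simpa [mul_assoc] using this
    exact gen _ (key h₁ j₁ fun _ => rfl) (key h₂ j₂ fun h => (hj h).symm) x
  let π : AmalgamatedProduct f₁ f₂ →* AmalgamatedProduct f₁ f₂ ⧸ N := QuotientGroup.mk' N
  have sec : ∀ {C : Type} [Group C] (i : C →* Monoid.Coprod A B) (hi : Function.Injective i)
      (j : (i.range.comap φ) →* AmalgamatedProduct f₁ f₂)
      (_ : ∀ x : i.range.comap φ, φ x = 1 → j x ∈ N),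
      ∃ s : C →* AmalgamatedProduct f₁ f₂ ⧸ N, ∀ (x : i.range.comap φ) (a : C),
        φ x = i a → s a = π (j x) := by
    intro C _ i hi j hjN
    have hex : ∀ a : C, ∃ x : i.range.comap φ, φ x = i a := by
      intro a
      obtain ⟨x, hx⟩ := hφ (i a)
      exact ⟨⟨x, a, hx.symm⟩, hx⟩
    choose t ht using hex
    have huniq : ∀ (x y : i.range.comap φ), φ x = φ y → π (j x) = π (j y) := by
      intro x y hxy
      rw [← mul_inv_eq_one, ← map_inv, ← map_mul, ← map_inv, ← map_mul]
      exact (QuotientGroup.eq_one_iff _).2 (hjN _ (by simp [hxy]))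
    refine ⟨MonoidHom.mk' (fun a => π (j (t a))) fun a b => ?_, fun x a hx => ?_⟩
    · rw [← map_mul, ← map_mul]
      exact huniq _ _ (by simp [ht])
    · exact huniq _ _ (by rw [ht, hx])
  obtain ⟨sA, hsA⟩ := sec iA Monoid.Coprod.inl_injective j₁ fun x hx => ⟨⟨x, hx⟩, rfl⟩
  obtain ⟨sB, hsB⟩ := sec iB Monoid.Coprod.inr_injective j₂ fun x hx => by exact ⟨⟨x, hx⟩, hj ⟨x, hx⟩⟩
  have hret : ∀ x, Monoid.Coprod.lift sA sB (φ (ψ x)) = π x := by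
    refine gen (MonoidHom.eqLocus (((Monoid.Coprod.lift sA sB).comp φ).comp ψ) π) ?_ ?_
    · intro x
      obtain ⟨a, ha⟩ : ∃ a, iA a = φ x := x.2
      change Monoid.Coprod.lift sA sB (φ x) = π (j₁ x)
      rw [← ha, ← hsA x a ha.symm]
      exact Monoid.Coprod.lift_apply_inl _ _ _
    · intro x
      obtain ⟨a, ha⟩ : ∃ a, iB a = φ x := x.2
      change Monoid.Coprod.lift sA sB (φ x) = π (j₂ x)
      rw [← ha, ← hsB x a ha.symm]
      exact Monoid.Coprod.lift_apply_inr _ _ _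
  have hinj : Function.Injective ψ := by
    rw [injective_iff_map_eq_one]
    intro x hx
    have : π x = 1 := by rw [← hret, hx, map_one, map_one]
    obtain ⟨h, rfl⟩ := (QuotientGroup.eq_one_iff _).1 this
    have : h = 1 := Subtype.ext hx
    rw [this, map_one]
  -- The range of `ψ` maps onto `A * B` and contains `φ.ker`, so it is everything.
  have hsurj : Function.Surjective ψ := by
    rw [← MonoidHom.range_eq_top, eq_top_iff]
    have hmap : ∀ y, y ∈ ψ.range.map φ := by
      have : (⊤ : Subgroup (Monoid.Coprod A B)) ≤ ψ.range.map φ := by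
        rw [← Monoid.Coprod.closure_range_union, Subgroup.closure_le]
        rintro _ (⟨a, rfl⟩ | ⟨a, rfl⟩)
        · obtain ⟨x, hx⟩ := hφ (iA a)
          exact ⟨x, ⟨j₁ ⟨x, a, hx.symm⟩, rfl⟩, hx⟩
        · obtain ⟨x, hx⟩ := hφ (iB a)
          exact ⟨x, ⟨j₂ ⟨x, a, hx.symm⟩, rfl⟩, hx⟩
      exact fun y => this (Subgroup.mem_top y)
    intro x _
    obtain ⟨y, hy, hyx⟩ := hmap (φ x)
    have hk : x * y⁻¹ ∈ H := by simp [H, MonoidHom.mem_ker, hyx]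
    have : x * y⁻¹ ∈ ψ.range := ⟨j₁ (f₁ ⟨_, hk⟩), rfl⟩
    simpa using mul_mem this hy
  exact ⟨(MulEquiv.ofBijective ψ ⟨hinj, hsurj⟩).symm⟩

/-! ### Spanning trees in graphs of orbits -/

section Spanning

variable {X : Type} {s u : X → X}

/-- The orbits of a permutation `u` with `u³ = 1`. -/
def orbitSetoidOfCube (u : X → X) (hu : ∀ x, u (u (u x)) = x) : Setoid X where
  r x y := y = x ∨ y = u x ∨ y = u (u x)
  iseqv :=
    { refl := fun _ => Or.inl rfl
      symm := by rintro x _ (rfl | rfl | rfl) <;> simp [hu]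
      trans := by rintro x _ _ (rfl | rfl | rfl) (rfl | rfl | rfl) <;> simp [hu] }

/-- Two maps `s`, `u` of a set `X` with `s² = 1` and `u³ = 1` make the `u`-orbits into the vertices
of a graph whose edges are the `s`-orbits; when it is connected, a spanning tree gives a small
`s`-stable subset `T` such that the `s`-moves inside `T` suffice for connectedness. -/
theorem exists_spanning_subset [Fintype X] [DecidableEq X] [Nonempty X]
    (hs : ∀ x, s (s x) = x) (hu : ∀ x, u (u (u x)) = x)
    [Fintype (Quotient (orbitSetoidOfCube u hu))]
    (hconn : ∀ r : X → X → Prop, Equivalence r → (∀ x, r x (u x)) → (∀ x, r x (s x)) →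
      ∀ x y, r x y) :
    ∃ T : Finset X, (∀ x ∈ T, s x ∈ T) ∧
      (∀ r : X → X → Prop, Equivalence r → (∀ x, r x (u x)) → (∀ x ∈ T, r x (s x)) →
        ∀ x y, r x y) ∧
      T.card + 2 ≤ 2 * Fintype.card (Quotient (orbitSetoidOfCube u hu)) := by
  classical
  let mk : X → Quotient (orbitSetoidOfCube u hu) := Quotient.mk _
  have hmk : ∀ x, mk x = mk (u x) := fun x => Quotient.sound (Or.inr (Or.inl rfl))
  let 𝒢 : SimpleGraph (Quotient (orbitSetoidOfCube u hu)) :=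
    { Adj a b := a ≠ b ∧ ∃ x, mk x = a ∧ mk (s x) = b
      symm := ⟨by
        rintro a b ⟨hab, x, rfl, rfl⟩
        exact ⟨hab.symm, s x, rfl, by rw [hs]⟩⟩
      loopless := ⟨fun a h => h.1 rfl⟩ }
  have h𝒢 : 𝒢.Connected := by
    have : ∀ x y, 𝒢.Reachable (mk x) (mk y) := by
      refine hconn _ ⟨fun _ => .rfl, fun h => h.symm, fun h h' => h.trans h'⟩ ?_ ?_
      · intro x
        rw [← hmk]
      · intro x
        by_cases h : mk x = mk (s x)
        · rw [← h]
        · exact SimpleGraph.Adj.reachable (G := 𝒢) ⟨h, x, rfl, rfl⟩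
    have hne : Nonempty (Quotient (orbitSetoidOfCube u hu)) := Nonempty.map mk inferInstance
    exact ⟨fun a b => Quotient.inductionOn₂ a b this⟩
  obtain ⟨𝒯, hle, h𝒯⟩ := h𝒢.exists_isTree_le
  have hedge : ∀ e : 𝒯.edgeSet, ∃ x, s(mk x, mk (s x)) = e.1 := by
    rintro ⟨e, he⟩
    induction e using Sym2.ind with
    | _ a b =>
      obtain ⟨-, x, rfl, rfl⟩ := hle he
      exact ⟨x, rfl⟩
  choose g hg using hedge
  -- A spanning tree on `V` vertices has `V - 1` edges, and each contributes at most the two points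
  -- `g e` and `s (g e)`; this gives the bound `2 * V - 2`.
  refine ⟨Finset.univ.image g ∪ Finset.univ.image (s ∘ g), ?_, ?_, ?_⟩
  · intro x hx
    simp only [Finset.mem_union, Finset.mem_image, Finset.mem_univ, true_and,
      Function.comp_apply] at hx ⊢
    rcases hx with ⟨e, rfl⟩ | ⟨e, rfl⟩
    · exact Or.inr ⟨e, rfl⟩
    · exact Or.inl ⟨e, (hs _).symm⟩
  · intro r hr hru hrs
    have hr' : ∀ x y, mk x = mk y → r x y := by
      intro x y h
      rcases Quotient.exact h with rfl | rfl | rfl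
      · exact hr.refl _
      · exact hru _
      · exact hr.trans (hru _) (hru _)
    have hwalk : ∀ a b, 𝒯.Walk a b → ∀ x y, mk x = a → mk y = b → r x y := by
      intro a b p
      induction p with
      | nil => exact fun x y hx hy => hr' x y (hx.trans hy.symm)
      | @cons a c b h p ih =>
        intro x y hx hy
        have h1 := hg ⟨s(a, c), h⟩
        set z := g ⟨s(a, c), h⟩ with hz
        have hzs : r z (s z) := hrs z (by simp [hz])
        rcases Sym2.eq_iff.1 h1 with ⟨h1, h2⟩ | ⟨h1, h2⟩
        · exact hr.trans (hr' x z (hx.trans h1.symm)) (hr.trans hzs (ih _ _ h2 hy))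
        · exact hr.trans (hr' x (s z) (hx.trans h2.symm)) (hr.trans (hr.symm hzs) (ih _ _ h1 hy))
    intro x y
    obtain ⟨p⟩ := h𝒯.connected.preconnected (mk x) (mk y)
    exact hwalk _ _ p x y rfl rfl
  · have h1 := h𝒯.card_edgeFinset
    have h2 : 𝒯.edgeFinset.card = Fintype.card 𝒯.edgeSet := SimpleGraph.edgeFinset_card
    have h3 := Finset.card_union_le (Finset.univ.image g) (Finset.univ.image (s ∘ g))
    have h4 : (Finset.univ.image g).card ≤ Fintype.card 𝒯.edgeSet := Finset.card_image_le
    have h5 : (Finset.univ.image (s ∘ g)).card ≤ Fintype.card 𝒯.edgeSet := Finset.card_image_le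
    omega

/-- A `u`-orbit has three points, or is a single fixed point, counted 1 + 2 times on the right. The
bound is the sum over the orbits. -/
theorem card_quotient_orbitSetoidOfCube [Fintype X] [DecidableEq X]
    (hu : ∀ x, u (u (u x)) = x) [Fintype (Quotient (orbitSetoidOfCube u hu))] :
    3 * Fintype.card (Quotient (orbitSetoidOfCube u hu)) ≤
      Fintype.card X + 2 * (Finset.univ.filter fun x => u x = x).card := by
  classical
  let mk : X → Quotient (orbitSetoidOfCube u hu) := Quotient.mk _
  have hmk : ∀ x, mk (u x) = mk x := fun x => (Quotient.sound (Or.inr (Or.inl rfl))).symm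
  have e₁ := Finset.card_eq_sum_card_fiberwise (s := (Finset.univ : Finset X)) (t := Finset.univ)
    (f := mk) (fun _ _ => by simp)
  have e₂ := Finset.card_eq_sum_card_fiberwise (s := Finset.univ.filter fun x => u x = x)
    (t := Finset.univ) (f := mk) (fun _ _ => by simp)
  rw [← Finset.card_univ (α := X), e₁, e₂, Finset.mul_sum, ← Finset.sum_add_distrib, mul_comm,
    ← smul_eq_mul]
  refine Finset.card_nsmul_le_sum _ _ _ fun q _ => ?_
  obtain ⟨x, rfl⟩ := Quotient.exists_rep q
  change 3 ≤ (Finset.univ.filter fun y => mk y = mk x).card + _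
  by_cases hx : u x = x
  · have h1 : 0 < (Finset.univ.filter fun y => mk y = mk x).card :=
      Finset.card_pos.2 ⟨x, by simp⟩
    have h2 : 0 < ((Finset.univ.filter fun x => u x = x).filter fun y => mk y = mk x).card :=
      Finset.card_pos.2 ⟨x, by simp [hx]⟩
    change 3 ≤ _ + 2 * ((Finset.univ.filter fun x => u x = x).filter fun y => mk y = mk x).card
    omega
  · have h1 : ({x, u x, u (u x)} : Finset X) ⊆ Finset.univ.filter fun y => mk y = mk x := by
      intro y hy
      simp only [Finset.mem_insert, Finset.mem_singleton] at hy
      rcases hy with rfl | rfl | rfl <;> simp [hmk]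
    have h2 : ({x, u x, u (u x)} : Finset X).card = 3 := by
      refine Finset.card_eq_three.2 ⟨x, u x, u (u x), fun h => hx h.symm, fun h => hx ?_,
        fun h => hx ?_, rfl⟩
      · calc u x = u (u (u x)) := congrArg u h
          _ = x := hu x
      · calc u x = u (u x) := h
          _ = u (u (u x)) := congrArg u h
          _ = x := hu x
    have := Finset.card_le_card h1
    omega

/-- With `f` fixed points of `u`, the two counts give `3 * |T| + 6 ≤ 2 * |X| + 4 * f`. If `f = 1`,
then `T` is not all of `X`; if `f = 0`, at least three points lie outside `T`, hence two distinct
`s`-orbits. Each alternative provides two independent places for a generator: a fixed point of `u`,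
or an `s`-orbit off `T`. -/
theorem exists_spanning_subset_with_complement [Fintype X] [DecidableEq X] [Nonempty X]
    (hs : ∀ x, s (s x) = x) (hu : ∀ x, u (u (u x)) = x)
    (hconn : ∀ r : X → X → Prop, Equivalence r → (∀ x, r x (u x)) → (∀ x, r x (s x)) →
      ∀ x y, r x y) :
    ∃ T : Finset X, (∀ x ∈ T, s x ∈ T) ∧
      (∀ r : X → X → Prop, Equivalence r → (∀ x, r x (u x)) → (∀ x ∈ T, r x (s x)) →
        ∀ x y, r x y) ∧
      ((∃ x y, x ≠ y ∧ u x = x ∧ u y = y) ∨ (∃ x y, u x = x ∧ y ∉ T) ∨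
        ∃ x y, x ∉ T ∧ y ∉ T ∧ y ≠ x ∧ y ≠ s x) := by
  classical
  obtain ⟨T, hTs, hT, hcard⟩ := exists_spanning_subset hs hu hconn
  refine ⟨T, hTs, hT, ?_⟩
  have hle := card_quotient_orbitSetoidOfCube hu
  have hpos : 0 < Fintype.card (Quotient (orbitSetoidOfCube u hu)) :=
    Fintype.card_pos_iff.2 (Nonempty.map (Quotient.mk _) inferInstance)
  have hout : ∀ U : Finset X, U.card < Fintype.card X → ∃ x, x ∉ U := by
    intro U hU
    by_contra! h
    rw [Finset.eq_univ_iff_forall.2 h, Finset.card_univ] at hU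
    exact lt_irrefl _ hU
  rcases lt_trichotomy 1 (Finset.univ.filter fun x => u x = x).card with h | h | h
  · obtain ⟨x, hx, y, hy, hxy⟩ := Finset.one_lt_card.1 h
    exact Or.inl ⟨x, y, hxy, by simpa using hx, by simpa using hy⟩
  · obtain ⟨x, hx⟩ := Finset.card_pos.1 (h ▸ one_pos)
    obtain ⟨y, hy⟩ := hout T (by omega)
    exact Or.inr (Or.inl ⟨x, y, by simpa using hx, hy⟩)
  · obtain ⟨x, hx⟩ := hout T (by omega)
    have h1 := Finset.card_union_le T {x, s x}
    have h2 := Finset.card_le_two (a := x) (b := s x)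
    obtain ⟨y, hy⟩ := hout (T ∪ {x, s x}) (by omega)
    simp only [Finset.mem_union, Finset.mem_insert, Finset.mem_singleton, not_or] at hy
    exact Or.inr (Or.inr ⟨x, y, hx, hy.1, hy.2.1, hy.2.2⟩)

end Spanning

/-! ### Finite-index subgroups of ℤ/2 * ℤ/3 -/

/-- A group generated by `s` and `u` with `s² = u³ = 1`, and universal for this property: the free
product of cyclic groups of orders `2` and `3`. -/
structure IsFreeProductTwoThree {P : Type} [Group P] (s u : P) : Prop where
  sq : s ^ 2 = 1
  cube : u ^ 3 = 1
  closure : Subgroup.closure {s, u} = ⊤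
  lift : ∀ (Q : Type) [Group Q] (a b : Q), a ^ 2 = 1 → b ^ 3 = 1 → ∃ f : P →* Q, f s = a ∧ f u = b

namespace IsFreeProductTwoThree

variable {P : Type} [Group P] {s u : P} (h : IsFreeProductTwoThree s u)

include h

theorem smul_s_smul {X : Type} [MulAction P X] (x : X) : s • s • x = x := by
  rw [smul_smul, ← pow_two, h.sq, one_smul]

theorem smul_u_smul {X : Type} [MulAction P X] (x : X) : u • u • u • x = x := by
  rw [smul_smul, smul_smul, ← pow_two, ← pow_succ, h.cube, one_smul]

/-- A cocycle on a `P`-set is given by its values at the generators. -/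
theorem exists_cocycle {X : Type} [MulAction P X] {K : Type} [Group K] (a b : X → K)
    (ha : ∀ x, a (s • x) * a x = 1) (hb : ∀ x, b (u • u • x) * b (u • x) * b x = 1) :
    ∃ c : P → X → K, c s = a ∧ c u = b ∧ ∀ p q x, c (p * q) x = c p x * c q (p⁻¹ • x) := by
  have hsi : s⁻¹ = s := inv_eq_of_mul_eq_one_left (by rw [← pow_two, h.sq])
  let φ : P →* MulAut (X → K) := mulAutArrow
  have hφ : ∀ p f x, φ p f x = f (p⁻¹ • x) := fun p f x => rfl
  -- A cocycle is the first component of a homomorphism into the semidirect product that lifts the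
  -- identity of `P`; the universal property only asks for the two relations on the lifted
  -- generators.
  obtain ⟨f, hfs, hfu⟩ := h.lift ((X → K) ⋊[φ] P) ⟨a, s⟩ ⟨b, u⟩ (by
      rw [pow_two]
      refine SemidirectProduct.ext ?_ ?_
      · funext x
        change a x * φ s a x = 1
        rw [hφ, hsi]
        simpa only [h.smul_s_smul] using ha (s • x)
      · change s * s = 1
        rw [← pow_two, h.sq]) (by
      rw [pow_succ, pow_two]
      refine SemidirectProduct.ext ?_ ?_
      · funext x
        change b x * φ u b x * φ (u * u) b x = 1
        rw [hφ, hφ]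
        have := hb (u⁻¹ • u⁻¹ • x)
        simp only [smul_inv_smul] at this
        rwa [mul_inv_rev, mul_smul]
      · change u * u * u = 1
        rw [← pow_two, ← pow_succ, h.cube])
  have hid : SemidirectProduct.rightHom.comp f = MonoidHom.id P := by
    refine MonoidHom.eq_of_eqOn_dense h.closure ?_
    rintro _ (rfl | rfl)
    · simp [hfs]
    · simp [hfu]
  refine ⟨fun p => (f p).left, by simp [hfs], by simp [hfu], fun p q x => ?_⟩
  have hp : (f p).right = p := DFunLike.congr_fun hid p
  change (f (p * q)).left x = _
  rw [map_mul, SemidirectProduct.mul_left, hp]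
  rfl

/-- The monodromy of a cocycle at the base point of `P ⧸ Λ` is onto as soon as the values of the
cocycle at the generators generate and are trivial along a connected part. -/
theorem exists_surjective_of_cocycle (Λ : Subgroup P) {K : Type} [Group K] (a b : P ⧸ Λ → K)
    (ha : ∀ x, a (s • x) = a x) (ha' : ∀ x, a x ^ 2 = 1) (hb : ∀ x, b x ^ 3 = 1)
    (hb' : ∀ x, u • x ≠ x → b x = 1)
    (T : Finset (P ⧸ Λ))
    (hT : ∀ r : P ⧸ Λ → P ⧸ Λ → Prop, Equivalence r → (∀ x, r x (u • x)) →
      (∀ x ∈ T, r x (s • x)) → ∀ x y, r x y)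
    (haT : ∀ x ∈ T, a x = 1) (S : Set K) (hS : Subgroup.closure S = ⊤)
    (hSab : S ⊆ Set.range a ∪ Set.range b) :
    ∃ χ : Λ →* K, Function.Surjective χ := by
  obtain ⟨c, hcs, hcu, hc⟩ := h.exists_cocycle a b (fun x => by rw [ha, ← pow_two, ha'])
    (fun x => by
      by_cases hx : u • x = x
      · rw [hx, hx, ← pow_two, ← pow_succ, hb]
      · have hx' : u • u • x ≠ u • x := fun h' => hx (MulAction.injective u h')
        have hx'' : u • u • u • x ≠ u • u • x := fun h' => hx' (MulAction.injective u h')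
        rw [hb' _ hx, hb' _ hx', hb' _ hx'', one_mul, one_mul])
  have hc1 : ∀ x, c 1 x = 1 := by
    intro x
    have := hc 1 1 x
    rw [one_mul, inv_one, one_smul] at this
    exact left_eq_mul.1 this
  let x₀ : P ⧸ Λ := QuotientGroup.mk 1
  have hmem : ∀ p : P, p • x₀ = x₀ ↔ p ∈ Λ := by
    intro p
    change (QuotientGroup.mk (p * 1) : P ⧸ Λ) = QuotientGroup.mk 1 ↔ _
    rw [mul_one, eq_comm, QuotientGroup.eq, inv_one, one_mul]
  let χ : Λ →* K := MonoidHom.mk' (fun p => c p x₀) fun p q => by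
    have : (p : P)⁻¹ • x₀ = x₀ := (hmem _).2 (inv_mem p.2)
    change c (p * q) x₀ = _
    rw [hc, this]
  refine ⟨χ, ?_⟩
  -- Any two points are joined by an element on which the cocycle is trivial. Pre- and
  -- post-composing with such elements turns each value `c t x` into the monodromy of a loop at
  -- `x₀`.
  have hr := hT (fun x y => ∃ p : P, p • y = x ∧ c p x = 1) ⟨?_, ?_, ?_⟩ ?_ ?_
  · have key : ∀ (t : P) (x : P ⧸ Λ), c t x ∈ χ.range := by
      intro t x
      obtain ⟨p, hp, hp'⟩ := hr x₀ x
      obtain ⟨q, hq, hq'⟩ := hr (t⁻¹ • x) x₀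
      have hpx : p⁻¹ • x₀ = x := by rw [← hp, inv_smul_smul]
      refine ⟨⟨p * (t * q), (hmem _).1 ?_⟩, ?_⟩
      · rw [mul_smul, mul_smul, hq, smul_inv_smul, hp]
      · change c (p * (t * q)) x₀ = _
        rw [hc, hc, hp', hpx, hq', one_mul, mul_one]
    rw [← MonoidHom.range_eq_top, eq_top_iff, ← hS, Subgroup.closure_le]
    intro k hk
    rcases hSab hk with ⟨x, rfl⟩ | ⟨x, rfl⟩
    · rw [← hcs]; exact key s x
    · rw [← hcu]; exact key u x
  · exact fun x => ⟨1, one_smul _ _, hc1 x⟩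
  · rintro x y ⟨p, rfl, hp⟩
    refine ⟨p⁻¹, inv_smul_smul _ _, ?_⟩
    have := hc p p⁻¹ (p • y)
    rw [mul_inv_cancel, hc1, hp, one_mul, inv_smul_smul] at this
    exact this.symm
  · rintro x y z ⟨p, rfl, hp⟩ ⟨q, rfl, hq⟩
    refine ⟨p * q, mul_smul _ _ _, ?_⟩
    rw [hc, hp, inv_smul_smul, hq, one_mul]
  · intro x
    by_cases hx : u • x = x
    · exact ⟨1, by rw [one_smul, hx], hc1 x⟩
    · refine ⟨u⁻¹, inv_smul_smul _ _, ?_⟩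
      have := hc u u⁻¹ (u • x)
      rw [mul_inv_cancel, hc1, hcu, inv_smul_smul,
        hb' _ fun h' => hx (MulAction.injective u h'), one_mul] at this
      exact this.symm
  · intro x hx
    exact ⟨s, h.smul_s_smul x, by rw [hcs, haT x hx]⟩

end IsFreeProductTwoThree

theorem Monoid.Coprod.closure_zmod (m n : ℕ) [NeZero m] [NeZero n] :
    Subgroup.closure ({Monoid.Coprod.inl (Multiplicative.ofAdd 1),
      Monoid.Coprod.inr (Multiplicative.ofAdd 1)} :
        Set (Monoid.Coprod (Multiplicative (ZMod m)) (Multiplicative (ZMod n)))) = ⊤ := by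
  have hpow : ∀ (k : ℕ) [NeZero k] (z : Multiplicative (ZMod k)),
      z = Multiplicative.ofAdd 1 ^ (Multiplicative.toAdd z).val := by
    intro k _ z
    rw [← ofAdd_nsmul, nsmul_one, ZMod.natCast_zmod_val, ofAdd_toAdd]
  rw [eq_top_iff, ← Monoid.Coprod.closure_range_union, Subgroup.closure_le]
  rintro _ (⟨z, rfl⟩ | ⟨z, rfl⟩)
  · rw [hpow m z, map_pow]
    exact pow_mem (Subgroup.subset_closure (by simp)) _
  · rw [hpow n z, map_pow]
    exact pow_mem (Subgroup.subset_closure (by simp)) _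

theorem pow_map_ofAdd_one {K : Type*} [Group K] (n : ℕ) (f : Multiplicative (ZMod n) →* K) :
    f (Multiplicative.ofAdd 1) ^ n = 1 := by
  rw [← map_pow, ← ofAdd_nsmul, nsmul_one, ZMod.natCast_self, ofAdd_zero, map_one]

open Monoid.Coprod in
/-- Every subgroup of finite index of `ℤ/2 * ℤ/3` maps onto a free product of two non-trivial cyclic
groups. -/
theorem IsFreeProductTwoThree.exists_surjective_coprod {P : Type} [Group P] {s u : P}
    (h : IsFreeProductTwoThree s u) (Λ : Subgroup P) [Λ.FiniteIndex] :
    ∃ m n : ℕ, 1 < m ∧ 1 < n ∧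
      ∃ χ : Λ →* Monoid.Coprod (Multiplicative (ZMod m)) (Multiplicative (ZMod n)),
        Function.Surjective χ := by
  classical
  let := Λ.fintypeQuotientOfFiniteIndex
  obtain ⟨T, hTs, hT, hex⟩ := exists_spanning_subset_with_complement (X := P ⧸ Λ)
    (s := fun x => s • x) (u := fun x => u • x) h.smul_s_smul h.smul_u_smul (by
      intro r hr hru hrs
      have hall : ∀ (p : P) (x : P ⧸ Λ), r x (p • x) := by
        intro p
        have : p ∈ Subgroup.closure {s, u} := h.closure ▸ Subgroup.mem_top p
        induction this using Subgroup.closure_induction with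
        | mem p hp =>
          rcases hp with rfl | rfl
          exacts [hrs, hru]
        | one => intro x; rw [one_smul]; exact hr.refl x
        | mul p q _ _ hp hq =>
          intro x
          rw [mul_smul]
          exact hr.trans (hq x) (hp _)
        | inv p _ hp =>
          intro x
          have := hp (p⁻¹ • x)
          rw [smul_inv_smul] at this
          exact hr.symm this
      intro x y
      obtain ⟨p, rfl⟩ := MulAction.exists_smul_eq P x y
      exact hall p x)
  have hss := h.smul_s_smul (X := P ⧸ Λ)
  have hswap : ∀ z y : P ⧸ Λ, (s • z = y ∨ s • z = s • y) ↔ (z = y ∨ z = s • y) := by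
    intro z y
    constructor
    · rintro (h1 | h1)
      · right; rw [← h1, hss]
      · left; exact MulAction.injective s h1
    · rintro (rfl | rfl)
      · right; rfl
      · left; rw [hss]
  have hTn : ∀ y ∉ T, ∀ z ∈ T, ¬ (z = y ∨ z = s • y) := by
    rintro y hy z hz (rfl | rfl)
    · exact hy hz
    · exact hy (by simpa only [hss] using hTs _ hz)
  -- A fixed point of `u` carries a generator of order 3 as value of `b`, and an `s`-orbit off `T`
  -- one of order 2 as value of `a`; all other values are 1. An `s`-orbit of two points could carry
  -- an element of infinite order, but order 2 avoids distinguishing it from a fixed point.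
  rcases hex with ⟨x, y, hxy, hx, hy⟩ | ⟨x, y, hx, hy⟩ | ⟨x, y, hx, hy, hyx, hysx⟩
  · refine ⟨3, 3, by norm_num, by norm_num, h.exists_surjective_of_cocycle Λ (fun _ => 1)
      (fun z => if z = x then inl (Multiplicative.ofAdd 1) else
        if z = y then inr (Multiplicative.ofAdd 1) else 1)
      (fun _ => rfl) (fun _ => one_pow _) (fun z => ?_) (fun z hz => ?_) T hT
      (fun _ _ => rfl) _ (closure_zmod 3 3) ?_⟩
    · split_ifs
      exacts [pow_map_ofAdd_one 3 _, pow_map_ofAdd_one 3 _, one_pow _]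
    · rw [if_neg, if_neg]
      · rintro rfl; exact hz hy
      · rintro rfl; exact hz hx
    · rintro _ (rfl | rfl)
      · exact Or.inr ⟨x, if_pos rfl⟩
      · exact Or.inr ⟨y, by dsimp only; rw [if_neg hxy.symm, if_pos rfl]⟩
  · refine ⟨3, 2, by norm_num, by norm_num, h.exists_surjective_of_cocycle Λ
      (fun z => if z = y ∨ z = s • y then inr (Multiplicative.ofAdd 1) else 1)
      (fun z => if z = x then inl (Multiplicative.ofAdd 1) else 1)
      (fun z => by simp only [hswap]) (fun z => ?_) (fun z => ?_) (fun z hz => ?_) T hT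
      (fun z hz => if_neg (hTn y hy z hz)) _ (closure_zmod 3 2) ?_⟩
    · split_ifs
      exacts [pow_map_ofAdd_one 2 _, one_pow _]
    · split_ifs
      exacts [pow_map_ofAdd_one 3 _, one_pow _]
    · rw [if_neg]
      rintro rfl; exact hz hx
    · rintro _ (rfl | rfl)
      · exact Or.inr ⟨x, if_pos rfl⟩
      · exact Or.inl ⟨y, if_pos (Or.inl rfl)⟩
  · refine ⟨2, 2, by norm_num, by norm_num, h.exists_surjective_of_cocycle Λ
      (fun z => if z = x ∨ z = s • x then inl (Multiplicative.ofAdd 1) else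
        if z = y ∨ z = s • y then inr (Multiplicative.ofAdd 1) else 1) (fun _ => 1)
      (fun z => by simp only [hswap]) (fun z => ?_) (fun _ => one_pow _) (fun _ _ => rfl) T hT
      (fun z hz => by rw [if_neg (hTn x hx z hz), if_neg (hTn y hy z hz)]) _ (closure_zmod 2 2) ?_⟩
    · split_ifs
      exacts [pow_map_ofAdd_one 2 _, pow_map_ofAdd_one 2 _, one_pow _]
    · rintro _ (rfl | rfl)
      · exact Or.inl ⟨x, if_pos (Or.inl rfl)⟩
      · refine Or.inl ⟨y, ?_⟩
        dsimp only
        rw [if_neg (not_or.2 ⟨hyx, hysx⟩), if_pos (Or.inl rfl)]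

/-! ### The modular group as a free product, by ping-pong -/

open scoped Pointwise

open Matrix in
/-- The action `M ↦ g M gᵀ` of `SL₂(ℤ)` on integral matrices; its kernel is `{±1}`. -/
def congruenceAction : SpecialLinearGroup (Fin 2) ℤ →* Equiv.Perm (Matrix (Fin 2) (Fin 2) ℤ) :=
  MonoidHom.toHomPerm
    { toFun g := fun M => g.1 * M * g.1ᵀ
      map_one' := by
        funext M
        change _ = M
        simp
      map_mul' g h := by
        funext M
        change _ = g.1 * (h.1 * M * h.1ᵀ) * g.1ᵀ
        simp [Matrix.mul_assoc] }

open Matrix in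
@[simp] theorem congruenceAction_apply (g : SpecialLinearGroup (Fin 2) ℤ)
    (M : Matrix (Fin 2) (Fin 2) ℤ) : congruenceAction g M = g.1 * M * g.1ᵀ := rfl

/-- The element `!![0, 1; -1, 1]` of order `6` of `SL₂(ℤ)`. -/
def ModularGroup.U : Matrix.SpecialLinearGroup (Fin 2) ℤ :=
  ⟨!![0, 1; -1, 1], by simp⟩

theorem ModularGroup.T_eq : ModularGroup.T = (ModularGroup.S * ModularGroup.U)⁻¹ := by
  rw [eq_inv_iff_mul_eq_one]
  apply Subtype.ext
  decide

theorem ModularGroup.closure_S_U :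
    Subgroup.closure {ModularGroup.S, ModularGroup.U} = ⊤ := by
  rw [eq_top_iff, ← SpecialLinearGroup.SL2Z_generators, Subgroup.closure_le]
  have hS : ModularGroup.S ∈ Subgroup.closure {ModularGroup.S, ModularGroup.U} :=
    Subgroup.subset_closure (by simp)
  have hU : ModularGroup.U ∈ Subgroup.closure {ModularGroup.S, ModularGroup.U} :=
    Subgroup.subset_closure (by simp)
  rintro _ (rfl | rfl)
  · exact hS
  · rw [ModularGroup.T_eq]
    exact inv_mem (mul_mem hS hU)

theorem congruenceAction_S_apply (M : Matrix (Fin 2) (Fin 2) ℤ) :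
    congruenceAction ModularGroup.S M = !![M 1 1, -M 1 0; -M 0 1, M 0 0] := by
  rw [congruenceAction_apply]
  ext i j
  fin_cases i <;> fin_cases j <;>
    simp [ModularGroup.S, Matrix.mul_apply, Matrix.vecMul, dotProduct, Fin.sum_univ_two]

theorem congruenceAction_U_apply (M : Matrix (Fin 2) (Fin 2) ℤ) :
    congruenceAction ModularGroup.U M =
      !![M 1 1, M 1 1 - M 1 0; M 1 1 - M 0 1, M 0 0 - M 0 1 - M 1 0 + M 1 1] := by
  rw [congruenceAction_apply]
  ext i j
  fin_cases i <;> fin_cases j <;>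
    simp [ModularGroup.U, Matrix.mul_apply, Matrix.vecMul, dotProduct, Fin.sum_univ_two] <;> ring

theorem congruenceAction_S_sq : congruenceAction ModularGroup.S ^ 2 = 1 := by
  ext1 M
  rw [pow_two, Equiv.Perm.mul_apply, congruenceAction_S_apply, congruenceAction_S_apply]
  ext i j
  fin_cases i <;> fin_cases j <;> simp

theorem congruenceAction_U_cube : congruenceAction ModularGroup.U ^ 3 = 1 := by
  ext1 M
  rw [pow_succ, pow_two, Equiv.Perm.mul_apply, Equiv.Perm.mul_apply, congruenceAction_U_apply,
    congruenceAction_U_apply, congruenceAction_U_apply]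
  ext i j
  fin_cases i <;> fin_cases j <;> simp <;> ring

theorem exists_zmod_hom {G : Type*} [Group G] (n : ℕ) (g : G) (hg : g ^ n = 1) :
    ∃ f : Multiplicative (ZMod n) →* G, f (Multiplicative.ofAdd 1) = g := by
  let f₀ : ZMod n →+ Additive G := ZMod.lift n ⟨zmultiplesHom _ (Additive.ofMul g), by
    simp [← ofMul_pow, hg]⟩
  refine ⟨AddMonoidHom.toMultiplicativeLeft f₀, ?_⟩
  have : f₀ 1 = Additive.ofMul g := by
    have := ZMod.lift_coe n ⟨zmultiplesHom _ (Additive.ofMul g), by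
      simp [← ofMul_pow, hg]⟩ 1
    simpa using this
  exact congrArg Additive.toMul this

theorem zmod_two_hom_apply {G : Type*} [Group G] (f : Multiplicative (ZMod 2) →* G)
    (m : Multiplicative (ZMod 2)) : m = 1 ∨ f m = f (Multiplicative.ofAdd 1) := by
  have : ∀ m : Multiplicative (ZMod 2), m = 1 ∨ m = Multiplicative.ofAdd 1 := by decide
  exact (this m).imp_right fun h => by rw [h]

theorem zmod_three_hom_apply {G : Type*} [Group G] (f : Multiplicative (ZMod 3) →* G)
    (m : Multiplicative (ZMod 3)) : m = 1 ∨ f m = f (Multiplicative.ofAdd 1) ∨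
      f m = f (Multiplicative.ofAdd 1) * f (Multiplicative.ofAdd 1) := by
  have : ∀ m : Multiplicative (ZMod 3), m = 1 ∨ m = Multiplicative.ofAdd 1 ∨
    m = Multiplicative.ofAdd 1 * Multiplicative.ofAdd 1 := by decide
  exact (this m).imp_right (Or.imp (fun h => by rw [h]) fun h => by rw [h, map_mul])

/-- The two cyclic factors of the modular group. -/
abbrev ModularFactor (i : Fin 2) : Type := Multiplicative (ZMod (![2, 3] i))

theorem ModularFactor.lift_mem {G : Type*} [Group G] (f : ∀ i, ModularFactor i →* G)
    (S : Subgroup G) (h₀ : f 0 (Multiplicative.ofAdd 1) ∈ S)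
    (h₁ : f 1 (Multiplicative.ofAdd 1) ∈ S) (x : Monoid.CoprodI ModularFactor) :
    Monoid.CoprodI.lift f x ∈ S := by
  induction x using Monoid.CoprodI.induction_on with
  | one => simp
  | of i m =>
    rw [Monoid.CoprodI.lift_of]
    fin_cases i
    · rcases zmod_two_hom_apply (f 0) m with h | h
      · change f 0 m ∈ S
        rw [show m = 1 from h, map_one]
        exact one_mem S
      · exact (congrArg (· ∈ S) h).mpr h₀
    · rcases zmod_three_hom_apply (f 1) m with h | h | h
      · change f 1 m ∈ S
        rw [show m = 1 from h, map_one]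
        exact one_mem S
      · exact (congrArg (· ∈ S) h).mpr h₁
      · exact (congrArg (· ∈ S) h).mpr (mul_mem h₁ h₁)
  | mul x y hx hy => rw [map_mul]; exact mul_mem hx hy

/-- The projective modular group is the free product of cyclic groups of orders `2` and `3`, stated
through the universal property of the free product. -/
theorem exists_projective_modular_group :
    ∃ (P : Type) (_ : Group P) (π : Matrix.SpecialLinearGroup (Fin 2) ℤ →* P) (s u : P),
      Function.Surjective π ∧ IsFreeProductTwoThree s u := by
  obtain ⟨f₀, hf₀⟩ := exists_zmod_hom 2 _ congruenceAction_S_sq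
  obtain ⟨f₁, hf₁⟩ := exists_zmod_hom 3 _ congruenceAction_U_cube
  let f : ∀ i, ModularFactor i →* Equiv.Perm (Matrix (Fin 2) (Fin 2) ℤ) :=
    Fin.cons f₀ (Fin.cons f₁ finZeroElim)
  -- The two sets differ in the sign of the off-diagonal entries. `S` swaps the diagonal and negates
  -- the off-diagonal, while the entries of the images of `X 0` under `U` and `U²` are sums of
  -- positive terms.
  let X : Fin 2 → Set (Matrix (Fin 2) (Fin 2) ℤ) :=
    ![{M | 0 < M 0 0 ∧ M 0 1 < 0 ∧ M 1 0 < 0 ∧ 0 < M 1 1},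
      {M | 0 < M 0 0 ∧ 0 < M 0 1 ∧ 0 < M 1 0 ∧ 0 < M 1 1}]
  have hinj : Function.Injective (Monoid.CoprodI.lift f) := by
    -- With only two factors, ping-pong needs one of them to have at least three elements; here it
    -- is the factor ℤ/3.
    refine Monoid.CoprodI.lift_injective_of_ping_pong f (Or.inr ⟨1, ?_⟩) X ?_ ?_ ?_
    · change (3 : Cardinal) ≤ Cardinal.mk (ZMod 3)
      simp
    · intro i
      fin_cases i
      · exact ⟨!![1, -1; -1, 1], by simp [X]⟩
      · exact ⟨!![1, 1; 1, 1], by simp [X]⟩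
    · have h01 : Disjoint (X 0) (X 1) := by
        rw [Set.disjoint_left]
        rintro M ⟨-, h, -⟩ ⟨-, h', -⟩
        exact lt_asymm h h'
      intro i j hij
      fin_cases i <;> fin_cases j
      · exact absurd rfl hij
      · exact h01
      · exact h01.symm
      · exact absurd rfl hij
    · have hpp0 : ∀ h : ModularFactor 0, h ≠ 1 → f 0 h • X 1 ⊆ X 0 := by
        intro h hh
        rw [show f 0 h = _ from ((zmod_two_hom_apply f₀ h).resolve_left hh).trans hf₀]
        rintro _ ⟨M, ⟨h1, h2, h3, h4⟩, rfl⟩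
        change congruenceAction ModularGroup.S M ∈ _
        rw [congruenceAction_S_apply]
        simp [X]
        omega
      have hpp1 : ∀ h : ModularFactor 1, h ≠ 1 → f 1 h • X 0 ⊆ X 1 := by
        intro h hh
        rcases (zmod_three_hom_apply f₁ h).resolve_left hh with h' | h' <;> rw [hf₁] at h'
        · rw [show f 1 h = _ from h']
          rintro _ ⟨M, ⟨h1, h2, h3, h4⟩, rfl⟩
          change congruenceAction ModularGroup.U M ∈ _
          rw [congruenceAction_U_apply]
          simp [X]
          omega
        · rw [show f 1 h = _ from h']
          rintro _ ⟨M, ⟨h1, h2, h3, h4⟩, rfl⟩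
          change congruenceAction ModularGroup.U (congruenceAction ModularGroup.U M) ∈ _
          rw [congruenceAction_U_apply, congruenceAction_U_apply]
          simp [X]
          omega
      intro i j hij
      fin_cases i <;> fin_cases j
      · exact absurd rfl hij
      · exact hpp0
      · exact hpp1
      · exact absurd rfl hij
  have hclos : Subgroup.closure {congruenceAction ModularGroup.S, congruenceAction ModularGroup.U}
      = congruenceAction.range := by
    rw [MonoidHom.range_eq_map, ← ModularGroup.closure_S_U, MonoidHom.map_closure, Set.image_pair]
  have hrange : (Monoid.CoprodI.lift f).range = congruenceAction.range := by
    refine le_antisymm ?_ ?_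
    · rintro _ ⟨x, rfl⟩
      refine ModularFactor.lift_mem f _ ?_ ?_ x
      · exact ⟨_, hf₀.symm⟩
      · exact ⟨_, hf₁.symm⟩
    · rw [← hclos, Subgroup.closure_le]
      rintro _ (rfl | rfl)
      · exact ⟨Monoid.CoprodI.of (i := 0) (Multiplicative.ofAdd 1), by
          rw [Monoid.CoprodI.lift_of]; exact hf₀⟩
      · exact ⟨Monoid.CoprodI.of (i := 1) (Multiplicative.ofAdd 1), by
          rw [Monoid.CoprodI.lift_of]; exact hf₁⟩
  let e : Monoid.CoprodI ModularFactor ≃* congruenceAction.range :=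
    (MonoidHom.ofInjective hinj).trans (MulEquiv.subgroupCongr hrange)
  have he₀ : e (Monoid.CoprodI.of (i := 0) (Multiplicative.ofAdd 1)) =
      congruenceAction.rangeRestrict ModularGroup.S :=
    Subtype.ext ((Monoid.CoprodI.lift_of f _).trans hf₀)
  have he₁ : e (Monoid.CoprodI.of (i := 1) (Multiplicative.ofAdd 1)) =
      congruenceAction.rangeRestrict ModularGroup.U :=
    Subtype.ext ((Monoid.CoprodI.lift_of f _).trans hf₁)
  refine ⟨congruenceAction.range, inferInstance, congruenceAction.rangeRestrict,
    congruenceAction.rangeRestrict ModularGroup.S, congruenceAction.rangeRestrict ModularGroup.U,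
    congruenceAction.rangeRestrict_surjective, Subtype.ext congruenceAction_S_sq,
    Subtype.ext congruenceAction_U_cube, ?_, ?_⟩
  · rw [← Set.image_pair, ← MonoidHom.map_closure, ModularGroup.closure_S_U,
      ← MonoidHom.range_eq_map, MonoidHom.range_eq_top]
    exact congruenceAction.rangeRestrict_surjective
  · intro Q _ a b ha hb
    obtain ⟨g₀, hg₀⟩ := exists_zmod_hom 2 a ha
    obtain ⟨g₁, hg₁⟩ := exists_zmod_hom 3 b hb
    let g : ∀ i, ModularFactor i →* Q := Fin.cons g₀ (Fin.cons g₁ finZeroElim)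
    refine ⟨(Monoid.CoprodI.lift g).comp e.symm.toMonoidHom, ?_, ?_⟩
    · rw [← he₀]
      simp only [MonoidHom.comp_apply, MulEquiv.coe_toMonoidHom, MulEquiv.symm_apply_apply,
        Monoid.CoprodI.lift_of]
      exact hg₀
    · rw [← he₁]
      simp only [MonoidHom.comp_apply, MulEquiv.coe_toMonoidHom, MulEquiv.symm_apply_apply,
        Monoid.CoprodI.lift_of]
      exact hg₁

/-- A group with a homomorphism to `SL₂(ℤ)` whose image has finite index is a non-trivial amalgamated
product. -/
theorem IsNontrivialAmalgam.of_hom_to_SL2Z {Γ : Type u} [Group Γ]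
    (θ : Γ →* Matrix.SpecialLinearGroup (Fin 2) ℤ) (hθ : θ.range.FiniteIndex) :
    IsNontrivialAmalgam Γ := by
  obtain ⟨P, _, π, s, u, hπ, hP⟩ := exists_projective_modular_group
  have hfin : (π.comp θ).range.FiniteIndex := by
    rw [MonoidHom.range_comp]
    refine ⟨fun h0 => hθ.index_ne_zero ?_⟩
    exact Nat.eq_zero_of_zero_dvd (h0 ▸ Subgroup.index_map_dvd θ.range hπ)
  obtain ⟨m, n, hm, hn, χ, hχ⟩ := hP.exists_surjective_coprod (π.comp θ).range
  have : Fact (1 < m) := ⟨hm⟩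
  have : Fact (1 < n) := ⟨hn⟩
  exact IsNontrivialAmalgam.of_surjective (χ.comp (π.comp θ).rangeRestrict)
    (hχ.comp (π.comp θ).rangeRestrict_surjective)

/-! ### Integral matrices as products of commutators in SL₂(ℚ) -/

open Matrix

/-- The image of `SL₂(ℤ)` in `SL₂(ℚ)` is contained in the derived subgroup. -/
theorem SL2Q_hom_eq_one {E : Type*} [CommMonoid E] (F : SpecialLinearGroup (Fin 2) ℚ →* E)
    (γ : SpecialLinearGroup (Fin 2) ℤ) :
    F (SpecialLinearGroup.map (Int.castRingHom ℚ) γ) = 1 := by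
  let F' : SpecialLinearGroup (Fin 2) ℤ →* E := F.comp (SpecialLinearGroup.map (Int.castRingHom ℚ))
  have hinv : ∀ g, F' g = 1 → F' g⁻¹ = 1 := by
    intro g hg
    have := map_mul F' g g⁻¹
    rwa [mul_inv_cancel, map_one, hg, one_mul, eq_comm] at this
  have hT : F' ModularGroup.T = 1 := by
    -- Conjugation by `a` multiplies the upper right entry by 4, so the commutator with `b` has
    -- entry 4/3 - 1/3 = 1.
    let a : SpecialLinearGroup (Fin 2) ℚ := ⟨!![2, 0; 0, 1 / 2], by simp⟩
    let b : SpecialLinearGroup (Fin 2) ℚ := ⟨!![1, 1 / 3; 0, 1], by simp⟩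
    have hab : SpecialLinearGroup.map (Int.castRingHom ℚ) ModularGroup.T = a * b * a⁻¹ * b⁻¹ := by
      rw [eq_mul_inv_iff_mul_eq, eq_mul_inv_iff_mul_eq]
      apply Subtype.ext
      change (!![1, 1; 0, 1] : Matrix _ _ ℤ).map (Int.castRingHom ℚ) * !![1, 1 / 3; 0, 1] *
        !![2, 0; 0, 1 / 2] = !![2, 0; 0, 1 / 2] * !![1, 1 / 3; 0, 1]
      ext i j
      fin_cases i <;> fin_cases j <;> norm_num [Matrix.mul_apply, Fin.sum_univ_two]
    change F _ = 1
    have comm : F (a * b * a⁻¹ * b⁻¹) = F (a * a⁻¹) * F (b * b⁻¹) := by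
      simp only [map_mul]
      ac_rfl
    rw [hab, comm, mul_inv_cancel, mul_inv_cancel, map_one, one_mul]
  have hS : F' ModularGroup.S = 1 := by
    -- This writes `S` as a product of conjugates of `T⁻¹`.
    have : ModularGroup.S = ModularGroup.T⁻¹ *
        (ModularGroup.S * ModularGroup.T⁻¹ * ModularGroup.S⁻¹) * ModularGroup.T⁻¹ := by
      apply Subtype.ext
      decide
    rw [this, map_mul, map_mul, hinv _ hT, map_mul, map_mul, hinv _ hT, mul_one, mul_one,
      one_mul, ← map_mul, mul_inv_cancel, map_one]
  have hmem : γ ∈ Subgroup.closure {ModularGroup.S, ModularGroup.T} := by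
    rw [SpecialLinearGroup.SL2Z_generators]
    exact Subgroup.mem_top γ
  change F' γ = 1
  induction hmem using Subgroup.closure_induction with
  | mem g hg =>
    rcases hg with rfl | rfl
    exacts [hS, hT]
  | one => exact map_one _
  | mul g g' _ _ hg hg' => rw [map_mul, hg, hg', one_mul]
  | inv g _ hg => exact hinv g hg

/-! ### Schur relations and the group algebra -/

section Schur

variable {R : Type*} [CommRing R] {G : Type u} [Group G] [Fintype G]

/-- The Schur orthogonality relations, with constant `c`, of a representation of degree `2`. -/
def SchurRelations (ρ : G →* Matrix (Fin 2) (Fin 2) R) (c : R) : Prop :=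
  ∀ i j k l, ∑ g, ρ g i j * ρ g⁻¹ k l = if j = k ∧ i = l then c else 0

/-- The extension of a representation to the group algebra. -/
noncomputable def groupAlgebraRep (ρ : G →* Matrix (Fin 2) (Fin 2) R) :
    MonoidAlgebra R G →ₐ[R] Matrix (Fin 2) (Fin 2) R :=
  MonoidAlgebra.lift R _ G ρ

/-- The element `∑ g, tr (ρ(g)⁻¹ M) g` of the group algebra. -/
noncomputable def traceElement (ρ : G →* Matrix (Fin 2) (Fin 2) R) :
    Matrix (Fin 2) (Fin 2) R →ₗ[R] MonoidAlgebra R G where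
  toFun M := ∑ g, MonoidAlgebra.single g (trace (ρ g⁻¹ * M))
  map_add' M N := by
    simp [Matrix.mul_add, MonoidAlgebra.single_add, Finset.sum_add_distrib]
  map_smul' r M := by
    simp [Finset.smul_sum, MonoidAlgebra.smul_single]

variable {ρ : G →* Matrix (Fin 2) (Fin 2) R} {c : R}

theorem traceElement_apply (M : Matrix (Fin 2) (Fin 2) R) :
    traceElement ρ M = ∑ g, MonoidAlgebra.single g (trace (ρ g⁻¹ * M)) := rfl

/-- The substitution `g ↦ h * g` moves `h` into the trace. Together with `traceElement_mul`, this
makes `traceElement ρ` a map of bimodules, so its image is a two-sided ideal. -/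
theorem mul_traceElement (a : MonoidAlgebra R G) (M : Matrix (Fin 2) (Fin 2) R) :
    a * traceElement ρ M = traceElement ρ (groupAlgebraRep ρ a * M) := by
  induction a using MonoidAlgebra.induction_linear with
  | zero => simp
  | add a b ha hb => rw [add_mul, ha, hb, map_add, add_mul, map_add]
  | single h r =>
    rw [groupAlgebraRep, MonoidAlgebra.lift_single, smul_mul_assoc, map_smul, traceElement_apply,
      traceElement_apply, Finset.mul_sum, Finset.smul_sum]
    refine Fintype.sum_equiv (Equiv.mulLeft h) _ _ fun g => ?_
    simp [MonoidAlgebra.single_mul_single, MonoidAlgebra.smul_single, ← Matrix.mul_assoc, ← map_mul]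

theorem traceElement_mul (a : MonoidAlgebra R G) (M : Matrix (Fin 2) (Fin 2) R) :
    traceElement ρ M * a = traceElement ρ (M * groupAlgebraRep ρ a) := by
  induction a using MonoidAlgebra.induction_linear with
  | zero => simp
  | add a b ha hb => rw [mul_add, ha, hb, map_add, mul_add, map_add]
  | single h r =>
    rw [groupAlgebraRep, MonoidAlgebra.lift_single, mul_smul_comm, map_smul, traceElement_apply,
      traceElement_apply, Finset.sum_mul, Finset.smul_sum]
    refine Fintype.sum_equiv (Equiv.mulRight h) _ _ fun g => ?_
    have htr : trace (ρ (g * h)⁻¹ * (M * ρ h)) = trace (ρ g⁻¹ * M) := by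
      rw [Matrix.trace_mul_comm, Matrix.mul_assoc, ← map_mul, _root_.mul_inv_rev,
        mul_inv_cancel_left, Matrix.trace_mul_comm]
    rw [Equiv.coe_mulRight, htr, MonoidAlgebra.single_mul_single, MonoidAlgebra.smul_single,
      smul_eq_mul, mul_comm]

/-- Expanding the trace leaves a combination of Schur sums. Thus `traceElement ρ` is a section of
the representation up to the factor `c`, which can be divided out over ℚ and dictates the level of
the congruence subgroup over ℤ. -/
theorem groupAlgebraRep_traceElement (h : SchurRelations ρ c) (M : Matrix (Fin 2) (Fin 2) R) :
    groupAlgebraRep ρ (traceElement ρ M) = c • M := by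
  ext i j
  have key : ∀ k l, ∑ g, ρ g⁻¹ k l * ρ g i j = if j = k ∧ i = l then c else 0 := by
    intro k l
    rw [← h i j k l]
    exact Finset.sum_congr rfl fun g _ => mul_comm _ _
  calc groupAlgebraRep ρ (traceElement ρ M) i j
      = ∑ g, (trace (ρ g⁻¹ * M)) * ρ g i j := by
        rw [traceElement_apply, map_sum, Matrix.sum_apply]
        simp [groupAlgebraRep, MonoidAlgebra.lift_single]
    _ = ∑ k, ∑ l, (∑ g, ρ g⁻¹ k l * ρ g i j) * M l k := by
        simp only [Matrix.trace, Matrix.diag, Matrix.mul_apply, Fin.sum_univ_two, Finset.sum_mul,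
          ← Finset.sum_add_distrib]
        refine Finset.sum_congr rfl fun g _ => ?_
        ring
    _ = (c • M) i j := by
        simp only [key]
        fin_cases i <;> fin_cases j <;> simp [Fin.sum_univ_two]

theorem traceElement_mul_traceElement (h : SchurRelations ρ c) (M N : Matrix (Fin 2) (Fin 2) R) :
    traceElement ρ M * traceElement ρ N = c • traceElement ρ (M * N) := by
  rw [mul_traceElement, groupAlgebraRep_traceElement h, smul_mul_assoc, map_smul]

end Schur

/-! ### The component M₂(ℚ) of ℚG -/

section RationalSplitting

variable {G : Type u} [Group G] [Fintype G] {ρ : G →* Matrix (Fin 2) (Fin 2) ℚ} {c : ℚ}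

/-- The embedding of `M₂(ℚ)` into `ℚG` as the simple component belonging to `ρ`. -/
noncomputable def componentSection (ρ : G →* Matrix (Fin 2) (Fin 2) ℚ) (c : ℚ) :
    Matrix (Fin 2) (Fin 2) ℚ →ₗ[ℚ] MonoidAlgebra ℚ G :=
  c⁻¹ • traceElement ρ

theorem groupAlgebraRep_componentSection (h : SchurRelations ρ c) (hc : c ≠ 0)
    (M : Matrix (Fin 2) (Fin 2) ℚ) : groupAlgebraRep ρ (componentSection ρ c M) = M := by
  rw [componentSection, LinearMap.smul_apply, map_smul, groupAlgebraRep_traceElement h,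
    inv_smul_smul₀ hc]

theorem mul_componentSection (a : MonoidAlgebra ℚ G) (M : Matrix (Fin 2) (Fin 2) ℚ) :
    a * componentSection ρ c M = componentSection ρ c (groupAlgebraRep ρ a * M) := by
  rw [componentSection, LinearMap.smul_apply, LinearMap.smul_apply, mul_smul_comm,
    mul_traceElement]

theorem componentSection_mul (a : MonoidAlgebra ℚ G) (M : Matrix (Fin 2) (Fin 2) ℚ) :
    componentSection ρ c M * a = componentSection ρ c (M * groupAlgebraRep ρ a) := by
  rw [componentSection, LinearMap.smul_apply, LinearMap.smul_apply, smul_mul_assoc,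
    traceElement_mul]

theorem componentSection_mul_componentSection (h : SchurRelations ρ c) (hc : c ≠ 0)
    (M N : Matrix (Fin 2) (Fin 2) ℚ) :
    componentSection ρ c M * componentSection ρ c N = componentSection ρ c (M * N) := by
  rw [mul_componentSection, groupAlgebraRep_componentSection h hc]

/-- The unital multiplicative map `M₂(ℚ) → ℚG` that is the identity in the component of `ρ` and
trivial in all the others. -/
noncomputable def componentHom (h : SchurRelations ρ c) (hc : c ≠ 0) :
    Matrix (Fin 2) (Fin 2) ℚ →* MonoidAlgebra ℚ G where
  toFun M := 1 - componentSection ρ c 1 + componentSection ρ c M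
  map_one' := by simp
  map_mul' M N := by
    simp only [add_mul, sub_mul, mul_add, mul_sub, componentSection_mul_componentSection h hc,
      one_mul, mul_one]
    abel

/-- Splitting off the component `M₂(ℚ)` of `ℚG`. -/
theorem exists_wedderburnDecomposition (h : SchurRelations ρ c) (hc : c ≠ 0) :
    ∃ (k : ℕ) (D : Fin k → Type u) (_ : ∀ i, DivisionRing (D i)) (n : Fin k → ℕ)
      (f : MonoidAlgebra ℚ G →+* Π i, Matrix (Fin (n i)) (Fin (n i)) (D i)),
      (∀ i, 0 < n i) ∧ Function.Bijective fun x => (groupAlgebraRep ρ x, f x) := by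
  have hcomm : ∀ x, componentSection ρ c 1 * x = x * componentSection ρ c 1 := fun x => by
    rw [mul_componentSection, componentSection_mul, one_mul, mul_one]
  -- `componentSection ρ c 1` is a central idempotent that generates the component of `ρ`; the
  -- remaining components are those of the semisimple quotient by `I`.
  let I : Ideal (MonoidAlgebra ℚ G) := Ideal.span {componentSection ρ c 1}
  have hI : ∀ x, x ∈ I ↔ x * componentSection ρ c 1 = x := by
    intro x
    rw [Ideal.mem_span_singleton']
    constructor
    · rintro ⟨a, rfl⟩
      rw [mul_assoc, componentSection_mul_componentSection h hc, one_mul]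
    · exact fun hx => ⟨x, hx⟩
  have : I.IsTwoSided := ⟨fun {a} b ha => by
    rw [hI] at ha ⊢
    rw [mul_assoc, ← hcomm, ← mul_assoc, ha]⟩
  have hss : IsSemisimpleRing (MonoidAlgebra ℚ G) := inferInstance
  have : IsSemisimpleRing (MonoidAlgebra ℚ G ⧸ I) :=
    RingHom.isSemisimpleRing_of_surjective (Ideal.Quotient.mk I) Ideal.Quotient.mk_surjective
  obtain ⟨k, D, n, _, hn, ⟨e⟩⟩ :=
    IsSemisimpleRing.exists_ringEquiv_pi_matrix_divisionRing (MonoidAlgebra ℚ G ⧸ I)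
  refine ⟨k, D, inferInstance, n, e.toRingHom.comp (Ideal.Quotient.mk I),
    fun i => Nat.pos_of_ne_zero (hn i).out, ?_, ?_⟩
  · intro x y hxy
    obtain ⟨h1, h2⟩ := Prod.mk.inj hxy
    have h2' : Ideal.Quotient.mk I x = Ideal.Quotient.mk I y := e.injective h2
    rw [Ideal.Quotient.eq, hI, mul_componentSection, map_sub, h1, sub_self, zero_mul, map_zero] at h2'
    exact (sub_eq_zero.1 h2'.symm)
  · rintro ⟨M, y⟩
    obtain ⟨b, hb⟩ := Ideal.Quotient.mk_surjective (e.symm y)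
    refine ⟨componentSection ρ c M + (b - b * componentSection ρ c 1), Prod.ext ?_ ?_⟩
    · change groupAlgebraRep ρ _ = M
      rw [map_add, map_sub, map_mul, groupAlgebraRep_componentSection h hc,
        groupAlgebraRep_componentSection h hc, mul_one, sub_self, add_zero]
    · change e (Ideal.Quotient.mk I _) = y
      rw [← e.eq_symm_apply, ← hb, Ideal.Quotient.eq, hI]
      simp only [add_mul, sub_mul, mul_assoc, componentSection_mul_componentSection h hc, mul_one]
      abel

end RationalSplitting

/-! ### Reduced norms in the components -/

/-- The reduced norm of a matrix over a field is its determinant. -/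
theorem HasReducedNorm.det_eq_one {F : Type u} [Field F] {n : ℕ} {A : Matrix (Fin n) (Fin n) F}
    (h : HasReducedNorm (Subring.center F) A 1) : A.det = 1 := by
  let e : Subring.center F ≃ₐ[Subring.center F] F :=
    AlgEquiv.ofBijective (Algebra.ofId _ F) ⟨Subtype.val_injective, fun x => ⟨⟨x, by
      rw [Subring.center_eq_top]; exact Subring.mem_top x⟩, rfl⟩⟩
  have := h (Subring.center F) n
    ((Algebra.TensorProduct.lid (Subring.center F) (Matrix (Fin n) (Fin n) F)).trans
      e.symm.mapMatrix)
  rw [AlgEquiv.trans_apply, Algebra.TensorProduct.lid_tmul, one_smul, map_one] at this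
  have h2 : e.symm A.det = 1 := by
    rw [← this]
    exact AlgHom.map_det e.symm.toAlgHom A
  rw [← e.apply_symm_apply A.det, h2, map_one]

/-- The hypothesis covers every Wedderburn decomposition, so it may be applied to one whose
component 0 is `ρ` itself; there the reduced norm is the determinant. `ULift` only moves ℚ to the
universe of `G`. -/
theorem HasReducedNormsOne.det_groupAlgebraRep {G : Type u} [Group G] [Fintype G]
    {ρ : G →* Matrix (Fin 2) (Fin 2) ℚ} {c : ℚ} (h : SchurRelations ρ c) (hc : c ≠ 0)
    {a : MonoidAlgebra ℚ G} (ha : HasReducedNormsOne a) : (groupAlgebraRep ρ a).det = 1 := by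
  obtain ⟨k, D, d, n, f, hn, hf⟩ := exists_wedderburnDecomposition h hc
  let D' : Fin (k + 1) → Type u := Fin.cons (ULift.{u} ℚ) D
  let n' : Fin (k + 1) → ℕ := Fin.cons 2 n
  let d₀ : DivisionRing (ULift.{u} ℚ) := inferInstance
  let d' : ∀ i, DivisionRing (D' i) := Fin.cases d₀ d
  let q : Matrix (Fin 2) (Fin 2) ℚ ≃+* Matrix (Fin 2) (Fin 2) (ULift.{u} ℚ) :=
    ULift.ringEquiv.symm.mapMatrix
  let f' : MonoidAlgebra ℚ G →+* Π i, Matrix (Fin (n' i)) (Fin (n' i)) (D' i) :=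
    RingHom.pi (Fin.cases (q.toRingHom.comp (groupAlgebraRep ρ).toRingHom)
      fun i => (Pi.evalRingHom _ i).comp f)
  have hf' : Function.Bijective f' := by
    constructor
    · intro x y hxy
      refine hf.1 (Prod.ext (q.injective (congrFun hxy 0)) (funext fun i => ?_))
      exact congrFun hxy i.succ
    · intro y
      obtain ⟨x, hx⟩ := hf.2 (q.symm (y 0), fun i => y i.succ)
      obtain ⟨h1, h2⟩ := Prod.mk.inj hx
      refine ⟨x, funext (Fin.cases ?_ fun i => ?_)⟩
      · change q (groupAlgebraRep ρ x) = y 0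
        rw [h1]
        exact q.apply_symm_apply _
      · exact congrFun h2 i
  let W : WedderburnDecomposition (MonoidAlgebra ℚ G) :=
    { k := k + 1
      D := D'
      n := n'
      n_pos := Fin.cases two_pos hn
      iso := RingEquiv.ofBijective f' hf' }
  have h0 : HasReducedNorm (Subring.center (ULift.{u} ℚ)) (q (groupAlgebraRep ρ a)) 1 := ha W 0
  have h1 := h0.det_eq_one
  have h2 : q (groupAlgebraRep ρ a) = (ULift.ringEquiv.symm : ℚ ≃+* ULift.{u} ℚ).toRingHom.mapMatrix
    (groupAlgebraRep ρ a) := rfl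
  rw [h2, ← RingHom.map_det] at h1
  exact (ULift.ringEquiv.symm : ℚ ≃+* ULift.{u} ℚ).injective (h1.trans (map_one _).symm)

/-- An element of `SL₂(ℤ)`, put into the component of `ρ`, has all its reduced norms equal to `1`. -/
theorem hasReducedNormsOne_componentHom {G : Type u} [Group G] [Fintype G]
    {ρ : G →* Matrix (Fin 2) (Fin 2) ℚ} {c : ℚ} (h : SchurRelations ρ c) (hc : c ≠ 0)
    (γ : SpecialLinearGroup (Fin 2) ℤ) :
    HasReducedNormsOne
      (componentHom h hc (SpecialLinearGroup.map (Int.castRingHom ℚ) γ).1) := by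
  intro W i E _ _ n φ
  -- For a fixed splitting, the determinant is multiplicative on SL₂(ℚ) with values in the
  -- commutative monoid `E`. Hence it is 1 on SL₂(ℤ), whichever component `i` is, and the components
  -- need not be matched with `ρ`.
  let F : SpecialLinearGroup (Fin 2) ℚ →* E :=
    ((((((Matrix.detMonoidHom : Matrix (Fin n) (Fin n) E →* E).comp φ.toRingEquiv.toMonoidHom).comp
      (Algebra.TensorProduct.includeRight (R := Subring.center (W.D i)) (A := E)
        (B := Matrix (Fin (W.n i)) (Fin (W.n i)) (W.D i))).toRingHom.toMonoidHom).comp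
      (Pi.evalMonoidHom _ i)).comp W.iso.toMonoidHom).comp
      (componentHom h hc)).comp SpecialLinearGroup.coeMonoidHom
  exact (SL2Q_hom_eq_one F γ).trans (map_one _).symm

/-! ### The representations of D₈ and S₃ -/

/-- The degree `2` representation of `D₈` as the symmetry group of a square. -/
def dihedralRepFun : DihedralGroup 4 → Matrix (Fin 2) (Fin 2) ℤ
  | .r i => ![!![1, 0; 0, 1], !![0, -1; 1, 0], !![-1, 0; 0, -1], !![0, 1; -1, 0]] i
  | .sr i => ![!![1, 0; 0, -1], !![0, -1; -1, 0], !![-1, 0; 0, 1], !![0, 1; 1, 0]] i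

def dihedralRep : DihedralGroup 4 →* Matrix (Fin 2) (Fin 2) ℤ where
  toFun := dihedralRepFun
  map_one' := by decide
  map_mul' := by decide +kernel

/-- The constant is the order of the group divided by the degree, 8/2 here and 6/2 for S₃. -/
theorem schurRelations_dihedralRep : SchurRelations dihedralRep 4 := by
  unfold SchurRelations
  decide +kernel

/-- The degree `2` representation of `S₃` on the vectors of `ℤ³` with coordinate sum `0`, in the basis
`e₀ - e₁`, `e₁ - e₂`. -/
def permRepFun (σ : Equiv.Perm (Fin 3)) : Matrix (Fin 2) (Fin 2) ℤ :=
  Matrix.of fun i j => if i = 0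
    then (if σ j.castSucc = 0 then 1 else 0) - (if σ j.succ = 0 then 1 else 0)
    else (if σ j.succ = 2 then 1 else 0) - (if σ j.castSucc = 2 then 1 else 0)

def permRep : Equiv.Perm (Fin 3) →* Matrix (Fin 2) (Fin 2) ℤ where
  toFun := permRepFun
  map_one' := by decide
  map_mul' := by decide +kernel

theorem schurRelations_permRep : SchurRelations permRep 3 := by
  unfold SchurRelations
  decide +kernel

/-- The Schur relations are inherited by inflation along a surjection. -/
theorem SchurRelations.comp {R : Type*} [CommRing R] {G D : Type*} [Group G] [Group D] [Fintype G]
    [Fintype D] {ρ : D →* Matrix (Fin 2) (Fin 2) R} {c : R} (h : SchurRelations ρ c) (f : G →* D)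
    (hf : Function.Surjective f) : SchurRelations (ρ.comp f) (Nat.card f.ker * c) := by
  classical
  intro i j k l
  have hcard : ∀ d : D, (Finset.univ.filter fun g => f g = d).card = Nat.card f.ker := by
    intro d
    rw [MonoidHom.card_fiber_eq_of_mem_range f (hf d) (hf 1), ← Fintype.card_subtype,
      ← Nat.card_eq_fintype_card]
    rfl
  calc ∑ g, (ρ.comp f) g i j * (ρ.comp f) g⁻¹ k l
      = ∑ g, ρ (f g) i j * ρ (f g)⁻¹ k l := by simp
    _ = ∑ d, (Finset.univ.filter fun g => f g = d).card • (ρ d i j * ρ d⁻¹ k l) := by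
        rw [← Finset.sum_fiberwise_of_maps_to (s := Finset.univ) (t := Finset.univ) (g := f)
          fun _ _ => Finset.mem_univ _]
        refine Finset.sum_congr rfl fun d _ => ?_
        rw [← Finset.sum_const]
        refine Finset.sum_congr rfl fun g hg => ?_
        rw [(Finset.mem_filter.1 hg).2]
    _ = if j = k ∧ i = l then Nat.card f.ker * c else 0 := by
        simp only [hcard, nsmul_eq_mul]
        rw [← Finset.mul_sum, h i j k l, mul_ite, mul_zero]

theorem exists_schurRelations (G : Type u) [Group G] [Fintype G]
    (hG : (∃ f : G →* DihedralGroup 4, Function.Surjective f) ∨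
      (∃ f : G →* Equiv.Perm (Fin 3), Function.Surjective f)) :
    ∃ (ρ : G →* Matrix (Fin 2) (Fin 2) ℤ) (c : ℕ), c ≠ 0 ∧ SchurRelations ρ (c : ℤ) := by
  rcases hG with ⟨f, hf⟩ | ⟨f, hf⟩
  · exact ⟨_, Nat.card f.ker * 4, mul_ne_zero Nat.card_pos.ne' (by norm_num),
      by exact_mod_cast schurRelations_dihedralRep.comp f hf⟩
  · exact ⟨_, Nat.card f.ker * 3, mul_ne_zero Nat.card_pos.ne' (by norm_num),
      by exact_mod_cast schurRelations_permRep.comp f hf⟩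

/-! ### Units of ℤG over a congruence subgroup -/

section IntegralRepBasics

variable {G : Type u} [Group G] {ρ : G →* Matrix (Fin 2) (Fin 2) ℤ}

/-- The determinant of a unit of `ℤG` in an integral representation. -/
noncomputable def unitDet (ρ : G →* Matrix (Fin 2) (Fin 2) ℤ) : (MonoidAlgebra ℤ G)ˣ →* ℤˣ :=
  Units.map ((Matrix.detMonoidHom : Matrix (Fin 2) (Fin 2) ℤ →* ℤ).comp
    (groupAlgebraRep ρ : MonoidAlgebra ℤ G →* Matrix (Fin 2) (Fin 2) ℤ))

theorem mem_ker_unitDet {a : (MonoidAlgebra ℤ G)ˣ} :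
    a ∈ (unitDet ρ).ker ↔ (groupAlgebraRep ρ (a : MonoidAlgebra ℤ G)).det = 1 := by
  rw [MonoidHom.mem_ker, Units.ext_iff]
  rfl

/-- The units of `ℤG` of determinant `1` in an integral representation map to `SL₂(ℤ)`. -/
noncomputable def unitsToSL (ρ : G →* Matrix (Fin 2) (Fin 2) ℤ) :
    (unitDet ρ).ker →* SpecialLinearGroup (Fin 2) ℤ where
  toFun a := ⟨groupAlgebraRep ρ (a.1 : MonoidAlgebra ℤ G), mem_ker_unitDet.1 a.2⟩
  map_one' := Subtype.ext (map_one (groupAlgebraRep ρ))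
  map_mul' _ _ := Subtype.ext (map_mul (groupAlgebraRep ρ) _ _)

/-- The rational representation belonging to an integral one. -/
def rationalRep (ρ : G →* Matrix (Fin 2) (Fin 2) ℤ) : G →* Matrix (Fin 2) (Fin 2) ℚ :=
  (Int.castRingHom ℚ).mapMatrix.toMonoidHom.comp ρ

theorem groupAlgebraRep_groupRingInclusion (a : MonoidAlgebra ℤ G) :
    groupAlgebraRep (rationalRep ρ) (groupRingInclusion G a) =
      (Int.castRingHom ℚ).mapMatrix (groupAlgebraRep ρ a) := by
  induction a using MonoidAlgebra.induction_linear with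
  | zero => simp
  | add a b ha hb => simp only [map_add, ha, hb]
  | single g r =>
    simp only [groupRingInclusion, MonoidAlgebra.mapRingHom_single, groupAlgebraRep,
      MonoidAlgebra.lift_single]
    ext i j
    change (r : ℚ) * (ρ g i j : ℚ) = ((r * ρ g i j : ℤ) : ℚ)
    rw [Int.cast_mul]

end IntegralRepBasics

section IntegralRep

variable {G : Type u} [Group G] [Fintype G] {ρ : G →* Matrix (Fin 2) (Fin 2) ℤ} {c : ℕ}

theorem SchurRelations.rationalRep (h : SchurRelations ρ (c : ℤ)) :
    SchurRelations (rationalRep ρ) (c : ℚ) := by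
  intro i j k l
  have := congrArg (Int.castRingHom ℚ) (h i j k l)
  rw [map_sum] at this
  simp only [map_mul] at this
  refine Eq.trans this ?_
  split_ifs <;> simp

theorem groupRingInclusion_traceElement (M : Matrix (Fin 2) (Fin 2) ℤ) :
    groupRingInclusion G (traceElement ρ M) =
      traceElement (rationalRep ρ) ((Int.castRingHom ℚ).mapMatrix M) := by
  rw [traceElement_apply, traceElement_apply, map_sum]
  refine Finset.sum_congr rfl fun g _ => ?_
  rw [groupRingInclusion, MonoidAlgebra.mapRingHom_single]
  congr 1
  simp [rationalRep, Matrix.trace, Matrix.mul_apply]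

/-- Elements of the principal congruence subgroup of level `c` come from units of `ℤG` that are
trivial in all other simple components. -/
theorem exists_unit_of_mem_Gamma (h : SchurRelations ρ (c : ℤ)) (hc : c ≠ 0)
    (γ : SpecialLinearGroup (Fin 2) ℤ) (hγ : γ ∈ CongruenceSubgroup.Gamma c) :
    ∃ u ∈ SL₁ (groupRingInclusion G), groupAlgebraRep ρ (u : MonoidAlgebra ℤ G) = γ.1 := by
  have hex : ∀ δ ∈ CongruenceSubgroup.Gamma c, ∃ x : Matrix (Fin 2) (Fin 2) ℤ,
      δ.1 = 1 + (c : ℤ) • x := by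
    intro δ hδ
    have hdvd : ∀ i j, (c : ℤ) ∣ (δ.1 - 1) i j := by
      intro i j
      rw [← ZMod.intCast_zmod_eq_zero_iff_dvd]
      have := congrFun (congrFun (congrArg Subtype.val hδ) i) j
      have h2 : ((δ.1 i j : ℤ) : ZMod c) = (1 : Matrix (Fin 2) (Fin 2) (ZMod c)) i j := this
      rw [Matrix.sub_apply, Int.cast_sub, h2, Matrix.one_apply, Matrix.one_apply]
      split_ifs <;> simp
    choose x hx using hdvd
    refine ⟨Matrix.of x, ?_⟩
    ext i j
    have := hx i j
    rw [Matrix.sub_apply, sub_eq_iff_eq_add'] at this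
    simpa using this
  obtain ⟨x, hx⟩ := hex γ hγ
  obtain ⟨y, hy⟩ := hex γ⁻¹ (inv_mem hγ)
  -- A product of two trace elements carries the same extra factor `c` as a product of `c • x` and
  -- `c • y`. So `1 + c • x ↦ 1 + traceElement ρ x` respects products, and the inverse of γ provides
  -- the inverse of the unit.
  have hprod : ∀ x y : Matrix (Fin 2) (Fin 2) ℤ, (1 + (c : ℤ) • x) * (1 + (c : ℤ) • y) = 1 →
      (1 + traceElement ρ x) * (1 + traceElement ρ y) = 1 := by
    intro x y hxy
    have h1 : (c : ℤ) • (x + y + (c : ℤ) • (x * y)) = 0 := by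
      rw [← sub_eq_zero.2 hxy]
      simp only [mul_add, add_mul, one_mul, mul_one, smul_mul_assoc, mul_smul_comm, smul_add]
      abel
    have h2 := (smul_eq_zero.1 h1).resolve_left (by exact_mod_cast hc)
    calc (1 + traceElement ρ x) * (1 + traceElement ρ y)
        = 1 + traceElement ρ (x + y + (c : ℤ) • (x * y)) := by
          rw [map_add, map_add, map_smul, ← traceElement_mul_traceElement h]
          noncomm_ring
      _ = 1 := by rw [h2, map_zero, add_zero]
  let u : (MonoidAlgebra ℤ G)ˣ :=
    { val := 1 + traceElement ρ x
      inv := 1 + traceElement ρ y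
      val_inv := hprod x y (by
        rw [← hx, ← hy]
        exact congrArg Subtype.val (mul_inv_cancel γ))
      inv_val := hprod y x (by
        rw [← hx, ← hy]
        exact congrArg Subtype.val (inv_mul_cancel γ)) }
  have hc' : (c : ℚ) ≠ 0 := by exact_mod_cast hc
  refine ⟨u, ?_, ?_⟩
  · have hu : groupRingInclusion G u = componentHom h.rationalRep hc'
        (SpecialLinearGroup.map (Int.castRingHom ℚ) γ).1 := by
      have h1 : (SpecialLinearGroup.map (Int.castRingHom ℚ) γ).1 =
          1 + (c : ℚ) • (Int.castRingHom ℚ).mapMatrix x := by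
        change (Int.castRingHom ℚ).mapMatrix γ.1 = _
        rw [hx, map_add, map_one]
        congr 1
        ext i j
        change (((c : ℤ) * x i j : ℤ) : ℚ) = (c : ℚ) * (x i j : ℚ)
        rw [Int.cast_mul, Int.cast_natCast]
      rw [h1]
      change groupRingInclusion G (1 + traceElement ρ x) =
        1 - componentSection _ _ 1 + componentSection _ _ _
      rw [map_add, map_add, map_one, groupRingInclusion_traceElement, map_smul, componentSection,
        LinearMap.smul_apply, LinearMap.smul_apply, smul_inv_smul₀ hc']
      abel
    change HasReducedNormsOne (groupRingInclusion G u)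
    rw [hu]
    exact hasReducedNormsOne_componentHom h.rationalRep hc' γ
  · change groupAlgebraRep ρ (1 + traceElement ρ x) = γ.1
    rw [map_add, map_one, groupAlgebraRep_traceElement h, hx]

/-- The determinant under `ρ` is one of the reduced norms, computed over ℚ and read back in ℤ. -/
theorem SL₁_le_ker_unitDet (h : SchurRelations ρ (c : ℤ)) (hc : c ≠ 0) :
    SL₁ (groupRingInclusion G) ≤ (unitDet ρ).ker := by
  intro a ha
  have hc' : (c : ℚ) ≠ 0 := by exact_mod_cast hc
  rw [mem_ker_unitDet]
  have h1 := HasReducedNormsOne.det_groupAlgebraRep h.rationalRep hc' (show HasReducedNormsOne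
    (groupRingInclusion G a) from ha)
  rw [groupAlgebraRep_groupRingInclusion, ← RingHom.map_det] at h1
  exact Int.cast_injective (h1.trans Int.cast_one.symm)

end IntegralRep

/-! ### Conclusion -/

/-- A subgroup of finite index in a group whose image has finite index has an image of finite
index. -/
theorem Subgroup.FiniteIndex.range_comp_subtype {A B : Type*} [Group A] [Group B] {f : A →* B}
    (hf : f.range.FiniteIndex) {H : Subgroup A} (hH : H.FiniteIndex) :
    (f.comp H.subtype).range.FiniteIndex := by
  rw [MonoidHom.range_comp, Subgroup.range_subtype]
  refine ⟨?_⟩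
  rw [Subgroup.index_map]
  exact mul_ne_zero (Subgroup.finiteIndex_of_le le_sup_left).index_ne_zero hf.index_ne_zero

/-- `G` maps onto `D₈`, the dihedral group of order `8` (`DihedralGroup 4` in Mathlib), or onto `S₃`.
Every subgroup of finite index of `SL₁(ℤG)` is a non-trivial amalgamated product, and `𝒰(ℤG)` is
virtually a non-trivial amalgamated product. -/
theorem corollary6p13 (G : Type u) [Group G] [Finite G]
    (hG : (∃ f : G →* DihedralGroup 4, Function.Surjective f) ∨
      (∃ f : G →* Equiv.Perm (Fin 3), Function.Surjective f)) :
    (∀ H : Subgroup (SL₁ (groupRingInclusion G)), H.FiniteIndex → IsNontrivialAmalgam H) ∧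
      IsVirtuallyNontrivialAmalgam (MonoidAlgebra ℤ G)ˣ := by
  have := Fintype.ofFinite G
  obtain ⟨ρ, c, hc, hρ⟩ := exists_schurRelations G hG
  have : NeZero c := ⟨hc⟩
  have hle := SL₁_le_ker_unitDet hρ hc
  let θ : SL₁ (groupRingInclusion G) →* SpecialLinearGroup (Fin 2) ℤ :=
    (unitsToSL ρ).comp (Subgroup.inclusion hle)
  have hθ : θ.range.FiniteIndex := by
    refine Subgroup.finiteIndex_of_le (H := CongruenceSubgroup.Gamma c) fun γ hγ => ?_
    obtain ⟨u, hu, huγ⟩ := exists_unit_of_mem_Gamma hρ hc γ hγ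
    exact ⟨⟨u, hu⟩, Subtype.ext huγ⟩
  -- For the full unit group, the finite-index subgroup is the kernel of the determinant, which
  -- takes values in the finite group `ℤˣ`. It contains SL₁(ℤG), so its image in SL₂(ℤ) contains
  -- that of `θ`.
  refine ⟨fun H hH => IsNontrivialAmalgam.of_hom_to_SL2Z (θ.comp H.subtype)
    (hθ.range_comp_subtype hH), (unitDet ρ).ker, Subgroup.finiteIndex_ker _,
    IsNontrivialAmalgam.of_hom_to_SL2Z (unitsToSL ρ) ?_⟩
  refine Subgroup.finiteIndex_of_le (H := θ.range) ?_
  rintro _ ⟨a, rfl⟩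
  exact ⟨_, rfl⟩
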